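/- A $k$-packing in a set family $\mathcal F$ is a set of $k$ mutually disjoint members of $\mathcal F$. There is a single deterministic algorithm which, given natural numbers $n,k,m$ and access by membership tests "$F\in\mathcal F$?" to a family $\mathcal F$ of $m$-element subsets of the $n$-element set $\{0,\dots,n-1\}$, outputs the number of $k$-packings in $\mathcal F$ in time $$O^*\!\left(5^{mk/2}\binom{n}{mk/2}\right)$$ if $k$ is even (if $k$ is odd, the same holds with $m\lceil k/2\rceil$ in place of $mk/2$), using space polynomial in $n$, $k$ and $m$. Here time is the number of bit operations of a register program (a membership test for a set written as a bit mask is charged the length of the mask), space is the maximum number of bits stored in the registers (access to $\mathcal F$ itself is not charged to space), and $O^*(g)$ means at most $P(n,k,m)\cdot\max(1,g)$ for a polynomial $P$ that does not depend on $n,k,m$ or $\mathcal F$. -/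

import Mathlib

/-! Register programs with bit-cost accounting and access to a set family by membership tests. -/

namespace Packing

/-- Arithmetic operations on natural numbers: addition, truncated subtraction, multiplication,
and integer division (with `a / 0 = 0`). -/
inductive Arith where
  | add
  | sub
  | mul
  | div

/-- The value of an arithmetic operation. -/
def Arith.value : Arith → ℕ → ℕ → ℕ
  | .add, a, b => a + b
  | .sub, a, b => a - b
  | .mul, a, b => a * b
  | .div, a, b => a / b

/-- The time charged for an arithmetic operation, in bit operations: linear in the lengths of the
operands for addition and subtraction, schoolbook cost for multiplication and division. -/
def Arith.cost : Arith → ℕ → ℕ → ℕ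
  | .add, a, b => a.size + b.size + 1
  | .sub, a, b => a.size + b.size + 1
  | .mul, a, b => (a.size + 1) * (b.size + 1)
  | .div, a, b => (a.size + 1) * (b.size + 1)

/-- Deterministic programs over `r` registers, each of which holds a natural number. -/
inductive Prog (r : ℕ) where
  /-- Do nothing. -/
  | skip : Prog r
  /-- `x := c`. -/
  | const (x : Fin r) (c : ℕ) : Prog r
  /-- `x := y`. -/
  | copy (x y : Fin r) : Prog r
  /-- `x := y o z`. -/
  | arith (o : Arith) (x y z : Fin r) : Prog r
  /-- `x := 1` if the oracle accepts the content of `y`, and `x := 0` otherwise. -/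
  | query (x y : Fin r) : Prog r
  /-- Run `p`, then `q`. -/
  | seq (p q : Prog r) : Prog r
  /-- Run `p` if `x ≠ 0`, and `q` otherwise. -/
  | ite (x : Fin r) (p q : Prog r) : Prog r
  /-- Run `p` repeatedly, as long as `x ≠ 0`. -/
  | loop (x : Fin r) (p : Prog r) : Prog r

/-- The number of bits stored in the registers. -/
def bits {r : ℕ} (σ : Fin r → ℕ) : ℕ := ∑ i, (σ i).size

/-- `Exec O p σ τ t s`: with oracle `O`, the program `p` started with register contents `σ` halts
with register contents `τ`; it takes time `t` (every instruction and every test is charged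
according to the lengths in bits of its operands), and `s` is the maximum number of bits stored
in the registers at any moment of the run. -/
inductive Exec {r : ℕ} (O : ℕ → Bool) :
    Prog r → (Fin r → ℕ) → (Fin r → ℕ) → ℕ → ℕ → Prop where
  | skip (σ : Fin r → ℕ) : Exec O .skip σ σ 1 (bits σ)
  | const (x : Fin r) (c : ℕ) (σ : Fin r → ℕ) :
      Exec O (.const x c) σ (Function.update σ x c) (c.size + 1)
        (max (bits σ) (bits (Function.update σ x c)))
  | copy (x y : Fin r) (σ : Fin r → ℕ) :
      Exec O (.copy x y) σ (Function.update σ x (σ y)) ((σ y).size + 1)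
        (max (bits σ) (bits (Function.update σ x (σ y))))
  | arith (o : Arith) (x y z : Fin r) (σ : Fin r → ℕ) :
      Exec O (.arith o x y z) σ (Function.update σ x (o.value (σ y) (σ z)))
        (o.cost (σ y) (σ z))
        (max (bits σ) (bits (Function.update σ x (o.value (σ y) (σ z)))))
  | query (x y : Fin r) (σ : Fin r → ℕ) :
      Exec O (.query x y) σ (Function.update σ x (O (σ y)).toNat) ((σ y).size + 1)
        (max (bits σ) (bits (Function.update σ x (O (σ y)).toNat)))
  | seq {p q : Prog r} {σ τ υ : Fin r → ℕ} {t t' s s' : ℕ} :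
      Exec O p σ τ t s → Exec O q τ υ t' s' → Exec O (.seq p q) σ υ (t + t') (max s s')
  | ite_pos {x : Fin r} {p q : Prog r} {σ τ : Fin r → ℕ} {t s : ℕ} :
      σ x ≠ 0 → Exec O p σ τ t s → Exec O (.ite x p q) σ τ ((σ x).size + 1 + t) s
  | ite_zero {x : Fin r} {p q : Prog r} {σ τ : Fin r → ℕ} {t s : ℕ} :
      σ x = 0 → Exec O q σ τ t s → Exec O (.ite x p q) σ τ ((σ x).size + 1 + t) s
  | loop_zero {x : Fin r} {p : Prog r} {σ : Fin r → ℕ} :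
      σ x = 0 → Exec O (.loop x p) σ σ ((σ x).size + 1) (bits σ)
  | loop_pos {x : Fin r} {p : Prog r} {σ τ υ : Fin r → ℕ} {t t' s s' : ℕ} :
      σ x ≠ 0 → Exec O p σ τ t s → Exec O (.loop x p) τ υ t' s' →
      Exec O (.loop x p) σ υ ((σ x).size + 1 + t + t') (max s s')

/-- The initial register contents: `n`, `k`, `m` in the first three registers, `0` elsewhere. -/
def input (r n k m : ℕ) : Fin (r + 3) → ℕ := fun i =>
  if i.val = 0 then n else if i.val = 1 then k else if i.val = 2 then m else 0

/-- The bit mask of a subset of `{0, …, n - 1}`, as a natural number. -/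
def mask {n : ℕ} (A : Finset (Fin n)) : ℕ := ∑ i ∈ A, 2 ^ i.val

/-- The membership test of a set family: accept exactly the bit masks of its members. -/
def memberTest {n : ℕ} (F : Finset (Finset (Fin n))) (v : ℕ) : Bool :=
  decide (∃ A ∈ F, mask A = v)

/-- The `k`-packings in `F`: the sets of `k` mutually disjoint members of `F`. -/
def packings {n : ℕ} (F : Finset (Finset (Fin n))) (k : ℕ) : Finset (Finset (Finset (Fin n))) :=
  (F.powersetCard k).filter fun P => ∀ A ∈ P, ∀ B ∈ P, A ≠ B → Disjoint A B

/-- The program `P` counts packings within time `T` and space `S`: for every family `F`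
of `m`-element subsets of an `n`-element set, `P` started on `n`, `k`, `m`, with membership tests
for `F`, halts with the number of `k`-packings in `F` in register `0`; it takes time at most
`T n k m`, and never stores more than `S n k m` bits. -/
def CountsPackings {r : ℕ} (P : Prog (r + 3)) (T S : ℕ → ℕ → ℕ → ℕ) : Prop :=
  ∀ (n k m : ℕ) (F : Finset (Finset (Fin n))), (∀ A ∈ F, A.card = m) →
    ∃ (τ : Fin (r + 3) → ℕ) (t s : ℕ),
      Exec (memberTest F) P (input r n k m) τ t s ∧
      τ 0 = (packings F k).card ∧ t ≤ T n k m ∧ s ≤ S n k m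

end Packing

/-! Split k as j + j', with j = ⌈k/2⌉ and j' = ⌊k/2⌋. If m ≥ 1, a k-packing listed in any of its k!
orders is a j-tuple and a j'-tuple of members of F whose unions have the full sizes mj and mj' and
are disjoint (`card_tuples_append`, `card_disjoint_tuples`). Disjointness of two sets U, U' is the
alternating sum of (-1)^|X| over X ⊆ U ∩ U'. So k! times the number of packings is the alternating
sum over X of a product of two covering numbers: how many j-tuples, and how many j'-tuples, have a
full-size union containing X (`sum_covering_mul_covering`).

A second inclusion-exclusion computes a covering number. Up to the sign (-1)^q, with q the full
size, it is the alternating sum over S of C(n - |X ∪ S|, n - q) · b(S)^j, where b(S) counts the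
members of F inside S (`sum_choose_mul_below_pow`). Only X and S with |X ∪ S| ≤ Q = mj contribute,
so nothing else is visited. No table is stored: b(S) is recomputed each time by testing all 2^|S|
subsets of S, which keeps the space polynomial.

Up to polynomial factors, the time is therefore the sum of 2^|S| over all pairs (X, S) with |X ∪ S|
≤ Q. An element of U = X ∪ S lies in X only (weight 1), in S only (weight 2) or in both (weight 2),
so each U contributes 5^|U| and the total is the sum of C(n,u) 5^u over u ≤ Q
(`sum_two_pow_card_of_union_le`). If k ≥ 2 and mk ≤ n, then 3Q ≤ 2n; in this range the terms
increase with u, and the last one dominates (`choose_mul_five_pow_mono`). The cases k ≤ 1, m = 0 and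
mk > n are treated separately.

Visiting only the relevant masks rests on `runs_enumProg`: a rejected mask lets a whole block be
skipped by adding its lowest bit, so at most about n rejections occur in a row. Costs are kept as
step counts N: with registers of at most B bits, a step costs at most (B + 1)^2, and B is polynomial
in n, k and m. -/

namespace Packing

/-! ### A calculus for register programs with bounded registers -/

section Calculus

variable {r : ℕ} {O : ℕ → Bool} {B : ℕ}

/-- Every register holds a number of at most `B` bits. -/
def Bounded (B : ℕ) (σ : Fin r → ℕ) : Prop := ∀ i, σ i < 2 ^ B

/-- Started in a state with registers of at most `B` bits, the program `P` halts in a state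
satisfying `Q`, it never uses a register of more than `B` bits, and it performs at most `N`
steps, each of them of cost at most `(B + 1) ^ 2`. -/
def Runs (O : ℕ → Bool) (B : ℕ) (P : Prog r) (σ : Fin r → ℕ) (N : ℕ)
    (Q : (Fin r → ℕ) → Prop) : Prop :=
  Bounded B σ → ∃ τ t s, Exec O P σ τ t s ∧ t ≤ N * (B + 1) ^ 2 ∧ s ≤ r * B ∧ Bounded B τ ∧ Q τ

theorem Bounded.size_le {σ : Fin r → ℕ} (h : Bounded B σ) (i : Fin r) : (σ i).size ≤ B :=
  Nat.size_le.2 (h i)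

theorem Bounded.bits_le {σ : Fin r → ℕ} (h : Bounded B σ) : bits σ ≤ r * B := by
  unfold bits
  calc ∑ i, (σ i).size ≤ ∑ _i : Fin r, B := Finset.sum_le_sum fun i _ => h.size_le i
    _ = r * B := by simp

theorem Bounded.update {σ : Fin r → ℕ} (h : Bounded B σ) (x : Fin r) {v : ℕ} (hv : v < 2 ^ B) :
    Bounded B (Function.update σ x v) := by
  intro i
  rcases eq_or_ne i x with rfl | hi
  · simpa using hv
  · simpa [hi] using h i

theorem Runs.mono {P : Prog r} {σ : Fin r → ℕ} {N N' : ℕ} {Q Q' : (Fin r → ℕ) → Prop}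
    (h : Runs O B P σ N Q) (hN : N ≤ N') (hQ : ∀ τ, Q τ → Q' τ) : Runs O B P σ N' Q' := by
  intro hb
  obtain ⟨τ, t, s, h1, h2, h3, h4, h5⟩ := h hb
  exact ⟨τ, t, s, h1, h2.trans (Nat.mul_le_mul_right _ hN), h3, h4, hQ _ h5⟩

theorem Runs.seq {p q : Prog r} {σ : Fin r → ℕ} {N N' : ℕ} {Q Q' : (Fin r → ℕ) → Prop}
    (h : Runs O B p σ N Q) (h' : ∀ τ, Q τ → Runs O B q τ N' Q') :
    Runs O B (.seq p q) σ (N + N') Q' := by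
  intro hb
  obtain ⟨τ, t, s, h1, h2, h3, h4, h5⟩ := h hb
  obtain ⟨υ, t', s', h1', h2', h3', h4', h5'⟩ := h' τ h5 h4
  exact ⟨υ, t + t', max s s', .seq h1 h1', by rw [add_mul]; omega, max_le h3 h3', h4', h5'⟩

theorem Runs.of_update {P : Prog r} {σ : Fin r → ℕ} {x : Fin r} {v t : ℕ}
    {Q : (Fin r → ℕ) → Prop}
    (h : Exec O P σ (Function.update σ x v) t (max (bits σ) (bits (Function.update σ x v))))
    (ht : Bounded B σ → t ≤ (B + 1) ^ 2) (hv : Bounded B σ → v < 2 ^ B)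
    (hQ : Q (Function.update σ x v)) : Runs O B P σ 1 Q := fun hb =>
  ⟨_, _, _, h, by simpa using ht hb, max_le hb.bits_le (hb.update x (hv hb)).bits_le,
    hb.update x (hv hb), hQ⟩

theorem Runs.const {σ : Fin r → ℕ} {x : Fin r} {c : ℕ} {Q : (Fin r → ℕ) → Prop}
    (hc : c < 2 ^ B) (hQ : Q (Function.update σ x c)) : Runs O B (.const x c) σ 1 Q := by
  refine .of_update (.const x c σ) (fun _ => ?_) (fun _ => hc) hQ
  have := Nat.size_le.2 hc
  nlinarith

theorem Runs.copy {σ : Fin r → ℕ} {x y : Fin r} {Q : (Fin r → ℕ) → Prop}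
    (hQ : Q (Function.update σ x (σ y))) : Runs O B (.copy x y) σ 1 Q := by
  refine .of_update (.copy x y σ) (fun hb => ?_) (fun hb => hb y) hQ
  have := hb.size_le y
  nlinarith

theorem Runs.query {σ : Fin r → ℕ} {x y : Fin r} {Q : (Fin r → ℕ) → Prop} (hB : 1 ≤ B)
    (hQ : Q (Function.update σ x (O (σ y)).toNat)) : Runs O B (.query x y) σ 1 Q := by
  refine .of_update (.query x y σ) (fun hb => ?_) (fun hb => ?_) hQ
  · have := hb.size_le y
    nlinarith
  · exact (Bool.toNat_le _).trans_lt (Nat.one_lt_two_pow (by omega))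

theorem Bounded.cost_le {σ : Fin r → ℕ} (hb : Bounded B σ) (o : Arith) (y z : Fin r) :
    o.cost (σ y) (σ z) ≤ (B + 1) ^ 2 := by
  have hy := hb.size_le y
  have hz := hb.size_le z
  cases o <;> simp only [Arith.cost] <;> nlinarith

theorem Runs.arith {σ : Fin r → ℕ} {o : Arith} {x y z : Fin r} {Q : (Fin r → ℕ) → Prop}
    (hv : Bounded B σ → o.value (σ y) (σ z) < 2 ^ B)
    (hQ : Q (Function.update σ x (o.value (σ y) (σ z)))) : Runs O B (.arith o x y z) σ 1 Q :=
  .of_update (.arith o x y z σ) (fun hb => hb.cost_le o y z) hv hQ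

theorem Runs.add {σ : Fin r → ℕ} {x y z : Fin r} {Q : (Fin r → ℕ) → Prop}
    (hv : Bounded B σ → σ y + σ z < 2 ^ B)
    (hQ : Q (Function.update σ x (σ y + σ z))) : Runs O B (.arith .add x y z) σ 1 Q :=
  .arith hv hQ

theorem Runs.mul {σ : Fin r → ℕ} {x y z : Fin r} {Q : (Fin r → ℕ) → Prop}
    (hv : Bounded B σ → σ y * σ z < 2 ^ B)
    (hQ : Q (Function.update σ x (σ y * σ z))) : Runs O B (.arith .mul x y z) σ 1 Q :=
  .arith hv hQ

theorem Runs.sub {σ : Fin r → ℕ} {x y z : Fin r} {Q : (Fin r → ℕ) → Prop}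
    (hQ : Q (Function.update σ x (σ y - σ z))) : Runs O B (.arith .sub x y z) σ 1 Q :=
  .arith (fun hb => (Nat.sub_le _ _).trans_lt (hb y)) hQ

theorem Runs.div {σ : Fin r → ℕ} {x y z : Fin r} {Q : (Fin r → ℕ) → Prop}
    (hQ : Q (Function.update σ x (σ y / σ z))) : Runs O B (.arith .div x y z) σ 1 Q :=
  .arith (fun hb => (Nat.div_le_self _ _).trans_lt (hb y)) hQ

/-! ### Rules for one instruction followed by a program. -/

theorem Runs.seq_of_update {p q : Prog r} {σ : Fin r → ℕ} {σ' : Fin r → ℕ} {N : ℕ}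
    {Q : (Fin r → ℕ) → Prop} (hp : Runs O B p σ 1 (· = σ')) (hq : Runs O B q σ' N Q) :
    Runs O B (.seq p q) σ (N + 1) Q :=
  (hp.seq (Q' := Q) (N' := N) (by rintro _ rfl; exact hq)).mono (by omega) fun _ h => h

theorem Runs.const_seq {σ : Fin r → ℕ} {x : Fin r} {c : ℕ} {q : Prog r} {N : ℕ}
    {Q : (Fin r → ℕ) → Prop} (hc : c < 2 ^ B) (hq : Runs O B q (Function.update σ x c) N Q) :
    Runs O B (.seq (.const x c) q) σ (N + 1) Q :=
  .seq_of_update (.const hc rfl) hq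

theorem Runs.copy_seq {σ : Fin r → ℕ} {x y : Fin r} {q : Prog r} {N : ℕ}
    {Q : (Fin r → ℕ) → Prop} (hq : Runs O B q (Function.update σ x (σ y)) N Q) :
    Runs O B (.seq (.copy x y) q) σ (N + 1) Q :=
  .seq_of_update (.copy rfl) hq

theorem Runs.query_seq {σ : Fin r → ℕ} {x y : Fin r} {q : Prog r} {N : ℕ}
    {Q : (Fin r → ℕ) → Prop} (hB : 1 ≤ B) (hq : Runs O B q (Function.update σ x (O (σ y)).toNat) N Q) :
    Runs O B (.seq (.query x y) q) σ (N + 1) Q :=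
  .seq_of_update (.query hB rfl) hq

theorem Runs.add_seq {σ : Fin r → ℕ} {x y z : Fin r} {q : Prog r} {N : ℕ}
    {Q : (Fin r → ℕ) → Prop} (hv : Bounded B σ → σ y + σ z < 2 ^ B) (hq : Runs O B q (Function.update σ x (σ y + σ z)) N Q) :
    Runs O B (.seq (.arith .add x y z) q) σ (N + 1) Q :=
  .seq_of_update (.add hv rfl) hq

theorem Runs.mul_seq {σ : Fin r → ℕ} {x y z : Fin r} {q : Prog r} {N : ℕ}
    {Q : (Fin r → ℕ) → Prop} (hv : Bounded B σ → σ y * σ z < 2 ^ B) (hq : Runs O B q (Function.update σ x (σ y * σ z)) N Q) :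
    Runs O B (.seq (.arith .mul x y z) q) σ (N + 1) Q :=
  .seq_of_update (.mul hv rfl) hq

theorem Runs.sub_seq {σ : Fin r → ℕ} {x y z : Fin r} {q : Prog r} {N : ℕ}
    {Q : (Fin r → ℕ) → Prop} (hq : Runs O B q (Function.update σ x (σ y - σ z)) N Q) :
    Runs O B (.seq (.arith .sub x y z) q) σ (N + 1) Q :=
  .seq_of_update (.sub rfl) hq

theorem Runs.div_seq {σ : Fin r → ℕ} {x y z : Fin r} {q : Prog r} {N : ℕ}
    {Q : (Fin r → ℕ) → Prop} (hq : Runs O B q (Function.update σ x (σ y / σ z)) N Q) :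
    Runs O B (.seq (.arith .div x y z) q) σ (N + 1) Q :=
  .seq_of_update (.div rfl) hq

theorem Runs.ite {p q : Prog r} {σ : Fin r → ℕ} {x : Fin r} {N : ℕ} {Q : (Fin r → ℕ) → Prop}
    (hp : σ x ≠ 0 → Runs O B p σ N Q) (hq : σ x = 0 → Runs O B q σ N Q) :
    Runs O B (.ite x p q) σ (N + 1) Q := by
  intro hb
  have hx : (σ x).size + 1 ≤ (B + 1) ^ 2 := by
    have := hb.size_le x
    nlinarith
  by_cases h : σ x = 0
  · obtain ⟨τ, t, s, h1, h2, h3, h4, h5⟩ := hq h hb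
    exact ⟨τ, _, s, .ite_zero h h1, by rw [add_mul]; omega, h3, h4, h5⟩
  · obtain ⟨τ, t, s, h1, h2, h3, h4, h5⟩ := hp h hb
    exact ⟨τ, _, s, .ite_pos h h1, by rw [add_mul]; omega, h3, h4, h5⟩

theorem Runs.loop_zero {p : Prog r} {σ : Fin r → ℕ} {x : Fin r} {N : ℕ}
    {Q : (Fin r → ℕ) → Prop} (hx : σ x = 0) (hQ : Q σ) :
    Runs O B (.loop x p) σ (N + 1) Q := by
  intro hb
  have : 1 ≤ (N + 1) * (B + 1) ^ 2 := Nat.succ_le_of_lt (by positivity)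
  exact ⟨σ, _, _, .loop_zero hx, by simpa [hx] using this, hb.bits_le, hb, hQ⟩

theorem Runs.loop_pos {p : Prog r} {σ : Fin r → ℕ} {x : Fin r} {N N' : ℕ}
    {Q Q' : (Fin r → ℕ) → Prop} (hx : σ x ≠ 0) (h : Runs O B p σ N Q)
    (h' : ∀ τ, Q τ → Runs O B (.loop x p) τ N' Q') :
    Runs O B (.loop x p) σ (N + 1 + N') Q' := by
  intro hb
  have hsize : (σ x).size + 1 ≤ (B + 1) ^ 2 := by
    have := hb.size_le x
    nlinarith
  obtain ⟨τ, t, s, h1, h2, h3, h4, h5⟩ := h hb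
  obtain ⟨υ, t', s', h1', h2', h3', h4', h5'⟩ := h' τ h5 h4
  exact ⟨υ, _, _, .loop_pos hx h1 h1', by rw [add_mul, add_mul]; omega, max_le h3 h3', h4', h5'⟩

/-- A loop that runs for `d` rounds of at most `N` steps, with invariant `I`. -/
theorem Runs.loop_rounds {p : Prog r} {x : Fin r} {N : ℕ} (I : ℕ → (Fin r → ℕ) → Prop)
    (h0 : ∀ σ, I 0 σ → σ x = 0) (hpos : ∀ d σ, I (d + 1) σ → σ x ≠ 0)
    (hstep : ∀ d σ, I (d + 1) σ → Runs O B p σ N (I d)) (d : ℕ) (σ : Fin r → ℕ) (hI : I d σ) :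
    Runs O B (.loop x p) σ (d * (N + 1) + 1) (I 0) := by
  induction d generalizing σ with
  | zero => simpa using Runs.loop_zero (N := 0) (h0 σ hI) hI
  | succ d ih =>
    exact (Runs.loop_pos (hpos d σ hI) (hstep d σ hI) ih).mono (by ring_nf; omega) fun _ h => h

/-- The states `σ` and `τ` agree on the registers below `b`. -/
def Agree (b : ℕ) (σ τ : Fin r → ℕ) : Prop := ∀ i : Fin r, i.val < b → τ i = σ i

theorem Agree.refl (b : ℕ) (σ : Fin r → ℕ) : Agree b σ σ := fun _ _ => rfl

theorem Agree.trans {b : ℕ} {σ τ υ : Fin r → ℕ} (h : Agree b σ τ) (h' : Agree b τ υ) :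
    Agree b σ υ := fun i hi => (h' i hi).trans (h i hi)

theorem Agree.of_le {b c : ℕ} {σ τ : Fin r → ℕ} (h : Agree c σ τ) (hbc : b ≤ c) :
    Agree b σ τ := fun i hi => h i (hi.trans_le hbc)

theorem Agree.update {b : ℕ} {σ τ : Fin r → ℕ} (h : Agree b σ τ) {x : Fin r} (hx : b ≤ x.val)
    (v : ℕ) : Agree b σ (Function.update τ x v) := by
  intro i hi
  have : i ≠ x := by rintro rfl; omega
  simpa [this] using h i hi

end Calculus

infixr:60 " ;; " => Prog.seq

/-! ### Subroutines -/

/-- The number of the `n` lowest binary digits which are `1` in `a` or in `b`. -/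
def unionCount : ℕ → ℕ → ℕ → ℕ
  | 0, _, _ => 0
  | n + 1, a, b => (a % 2 + b % 2 + 1) / 2 + unionCount n (a / 2) (b / 2)

theorem unionCount_le (n a b : ℕ) : unionCount n a b ≤ n := by
  induction n generalizing a b with
  | zero => simp [unionCount]
  | succ n ih =>
    have := ih (a / 2) (b / 2)
    simp only [unionCount]
    omega

section Subroutines

variable {O : ℕ → Bool} {B : ℕ}

/-- This encodes the register convention: registers from 30 on are scratch space and return values
of subroutines, while data that must survive a call lives below 30. Registers 4 and 5 hold the
constants 1 and 2. -/
theorem ne_of_lt_thirty {i j : Fin 40} (hi : i.val < 30) (hj : 30 ≤ j.val) : i ≠ j := by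
  rintro rfl
  omega

/-- Register `30` gets `unionCount n` of the registers `x` and `y`. -/
def unionCountProg (x y : Fin 40) : Prog 40 :=
  .const 30 0 ;; .copy 31 x ;; .copy 32 y ;; .copy 38 0 ;; .loop 38
    (.arith .div 33 31 5 ;; .arith .mul 34 33 5 ;; .arith .sub 35 31 34 ;;
      .arith .div 36 32 5 ;; .arith .mul 34 36 5 ;; .arith .sub 37 32 34 ;;
      .arith .add 35 35 37 ;; .arith .add 35 35 4 ;; .arith .div 35 35 5 ;;
      .arith .add 30 30 35 ;; .copy 31 33 ;; .copy 32 36 ;; .arith .sub 38 38 4)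

theorem runs_unionCountProg {x y : Fin 40} (hx : x.val < 30) (hy : y.val < 30) {n : ℕ}
    (hn : n + 3 < 2 ^ B) {σ : Fin 40 → ℕ} (h0 : σ 0 = n) (h4 : σ 4 = 1) (h5 : σ 5 = 2) :
    Runs O B (unionCountProg x y) σ (14 * n + 5)
      fun τ => τ 30 = unionCount n (σ x) (σ y) ∧ Agree 30 σ τ := by
  refine .const_seq (by omega) (.copy_seq (.copy_seq (.copy_seq ?_)))
  -- Invariant: the accumulator plus the count over the d digits still unread is the final value.
  refine (Runs.loop_rounds (N := 13) (fun d τ => τ 38 = d ∧ Agree 30 σ τ ∧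
    τ 30 + unionCount d (τ 31) (τ 32) = unionCount n (σ x) (σ y)) ?_ ?_ ?_ n _ ?_).mono
    (by omega) ?_
  · rintro τ ⟨h, -⟩; exact h
  · rintro d τ ⟨h, -⟩; omega
  · rintro d τ ⟨h38, hA, hu⟩
    have e4 : τ 4 = 1 := (hA 4 (by decide)).trans h4
    have e5 : τ 5 = 2 := (hA 5 (by decide)).trans h5
    have hU := unionCount_le n (σ x) (σ y)
    simp only [unionCount] at hu
    refine .div_seq (.mul_seq ?_ (.sub_seq (.div_seq (.mul_seq ?_ (.sub_seq (.add_seq ?_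
      (.add_seq ?_ (.div_seq (.add_seq ?_ (.copy_seq (.copy_seq (.sub ?_))))))))))))
    · intro hb
      have := hb 31
      simp [e5] at this ⊢
      omega
    · intro hb
      have := hb 32
      simp [e5] at this ⊢
      omega
    · intro hb
      simp [e5]
      omega
    · intro hb
      simp [e5, e4]
      omega
    · intro hb
      simp [e5, e4]
      omega
    · refine ⟨by simp [h38, e4], ?_, ?_⟩
      · repeat' refine Agree.update ?_ (by decide) _
        exact hA
      · simp [e5, e4]
        rw [← hu]
        have h1 : τ 31 - τ 31 / 2 * 2 = τ 31 % 2 := by omega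
        have h2 : τ 32 - τ 32 / 2 * 2 = τ 32 % 2 := by omega
        rw [h1, h2]
        omega
  · refine ⟨by simp [h0], ?_, ?_⟩
    · repeat' refine Agree.update ?_ (by decide) _
      exact .refl _ _
    · simp [ne_of_lt_thirty hx, ne_of_lt_thirty hy]
  · rintro τ ⟨-, hA, hu⟩
    exact ⟨by simpa [unionCount] using hu, hA⟩

/-- Register `x` gets the sum of its content and the lowest power of two in its binary expansion. -/
def addLowBit (x : Fin 40) : Prog 40 :=
  .const 30 1 ;; .copy 31 x ;;
    .arith .div 32 31 5 ;; .arith .mul 33 32 5 ;; .arith .sub 33 31 33 ;; .arith .sub 34 4 33 ;;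
    .loop 34
      (.copy 31 32 ;; .arith .mul 30 30 5 ;;
        .arith .div 32 31 5 ;; .arith .mul 33 32 5 ;; .arith .sub 33 31 33 ;;
        .arith .sub 34 4 33) ;;
    .arith .add x x 30

theorem runs_addLowBit {x : Fin 40} (hx : x.val < 30) {n v o : ℕ} (hn : 2 ^ n < 2 ^ B)
    (hB : 1 ≤ B) {σ : Fin 40 → ℕ} (hxv : σ x = 2 ^ v * (2 * o + 1)) (hlt : σ x < 2 ^ n)
    (h4 : σ 4 = 1) (h5 : σ 5 = 2) :
    Runs O B (addLowBit x) σ (7 * n + 8)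
      fun τ => τ x = 2 ^ v * (2 * o + 2) ∧ ∀ i : Fin 40, i.val < 30 → i ≠ x → τ i = σ i := by
  have h1B : 1 < 2 ^ B := Nat.one_lt_two_pow (by omega)
  have hvn : v < n := by
    by_contra hc
    have : 2 ^ n ≤ 2 ^ v := Nat.pow_le_pow_right (by norm_num) (by omega)
    nlinarith [Nat.zero_le (2 ^ v * o)]
  have hhalf : ∀ d, 2 ^ (d + 1) * (2 * o + 1) / 2 = 2 ^ d * (2 * o + 1) := fun d => by
    rw [pow_succ, mul_right_comm, Nat.mul_div_cancel _ (by norm_num)]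
  -- The loop flag is one minus the last digit, so the halving continues exactly while the number is
  -- even.
  have hpar : ∀ d, 1 - (2 ^ d * (2 * o + 1) - 2 ^ d * (2 * o + 1) / 2 * 2) =
      if d = 0 then 0 else 1 := fun d => by
    rcases d with _ | d
    · simp; omega
    · rw [hhalf, pow_succ, mul_right_comm]; simp
  refine .const_seq h1B (.copy_seq (.div_seq (.mul_seq ?_ (.sub_seq (.sub_seq ?_)))))
  · intro hb
    have := hb 31
    simp [h5] at this ⊢
    omega
  have hloop := fun τ (hτ : (fun d τ => d ≤ v ∧ Agree 30 σ τ ∧ τ 31 = 2 ^ d * (2 * o + 1) ∧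
      τ 32 = τ 31 / 2 ∧ τ 34 = (if d = 0 then 0 else 1) ∧ τ 30 * 2 ^ d = 2 ^ v) v τ) =>
    Runs.loop_rounds (O := O) (B := B) (x := 34) (p := .copy 31 32 ;; .arith .mul 30 30 5 ;;
        .arith .div 32 31 5 ;; .arith .mul 33 32 5 ;; .arith .sub 33 31 33 ;;
        .arith .sub 34 4 33) (N := 6) (fun d τ => d ≤ v ∧ Agree 30 σ τ ∧
          τ 31 = 2 ^ d * (2 * o + 1) ∧ τ 32 = τ 31 / 2 ∧ τ 34 = (if d = 0 then 0 else 1) ∧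
          τ 30 * 2 ^ d = 2 ^ v) ?_ ?_ ?_ v τ hτ
  · refine ((hloop _ ?_).seq (N' := 1) (Q' := fun τ => τ x = 2 ^ v * (2 * o + 2) ∧
      ∀ i : Fin 40, i.val < 30 → i ≠ x → τ i = σ i) ?_).mono (by nlinarith) fun _ h => h
    · refine ⟨le_rfl, ?_, ?_, ?_, ?_, ?_⟩
      · repeat' refine Agree.update ?_ (by decide) _
        exact .refl _ _
      · simp [ne_of_lt_thirty hx, hxv]
      · simp [ne_of_lt_thirty hx, h5]
      · simp [ne_of_lt_thirty hx, hxv, h5, h4]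
        exact hpar v
      · simp
    · rintro τ ⟨-, hA, -, -, -, h30⟩
      have ex := hA x hx
      have e30 : τ 30 = 2 ^ v := by simpa using h30
      refine .add (fun hb => ?_) ⟨?_, ?_⟩
      · rw [ex, hxv, e30]
        rw [hxv] at hlt
        refine lt_of_le_of_lt ?_ hn
        -- The sum may equal 2 ^ n but cannot exceed it: 2o + 1 is below the even number 2 ^ (n -
        -- v), hence 2o + 2 is at most that number.
        obtain ⟨w, rfl⟩ := Nat.exists_eq_add_of_lt hvn
        have h2 : 2 ^ (v + w + 1) = 2 ^ v * (2 * 2 ^ w) := by ring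
        rw [h2] at hlt ⊢
        have := Nat.lt_of_mul_lt_mul_left hlt
        nlinarith [Nat.mul_le_mul_left (2 ^ v) (show 2 * o + 1 + 1 ≤ 2 * 2 ^ w by omega)]
      · simp [ex, hxv, e30]; ring
      · intro i hi hix
        simpa [hix] using hA i hi
  · rintro τ ⟨-, -, -, -, h, -⟩; simpa using h
  · rintro d τ ⟨-, -, -, -, h, -⟩; simp [h]
  · rintro d τ ⟨hd, hA, h31, h32, h34, h30⟩
    have e4 : τ 4 = 1 := (hA 4 (by decide)).trans h4
    have e5 : τ 5 = 2 := (hA 5 (by decide)).trans h5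
    rw [h31, hhalf] at h32
    refine .copy_seq (.mul_seq ?_ (.div_seq (.mul_seq ?_ (.sub_seq (.sub ?_)))))
    · intro hb
      simp [e5]
      have h3 : τ 30 * 2 * 2 ^ d = 2 ^ v := by rw [← h30]; ring
      calc τ 30 * 2 ≤ τ 30 * 2 * 2 ^ d := Nat.le_mul_of_pos_right _ (by positivity)
        _ = 2 ^ v := h3
        _ < 2 ^ n := Nat.pow_lt_pow_right (by norm_num) hvn
        _ < 2 ^ B := hn
    · intro hb
      have := hb 31
      simp [e5] at this ⊢
      omega
    · refine ⟨by omega, ?_, ?_, ?_, ?_, ?_⟩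
      · repeat' refine Agree.update ?_ (by decide) _
        exact hA
      · simp [h32]
      · simp [e5]
      · simp [e5, e4, h32]
        exact hpar d
      · simp [e5]
        rw [← h30]; ring

/-- Register `30` gets the power of register `x` with exponent in register `y`. -/
def powProg (x y : Fin 40) : Prog 40 :=
  .const 30 1 ;; .copy 31 y ;; .loop 31 (.arith .mul 30 30 x ;; .arith .sub 31 31 4)

theorem runs_powProg {x y : Fin 40} (hx : x.val < 30) (hy : y.val < 30) {j : ℕ} (hB : 1 ≤ B)
    {σ : Fin 40 → ℕ} (hj : σ y = j) (hpow : ∀ i ≤ j, (σ x) ^ i < 2 ^ B) (h4 : σ 4 = 1) :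
    Runs O B (powProg x y) σ (3 * j + 3) fun τ => τ 30 = (σ x) ^ j ∧ Agree 30 σ τ := by
  refine .const_seq (Nat.one_lt_two_pow (by omega)) (.copy_seq ?_)
  refine (Runs.loop_rounds (N := 2) (fun d τ => d ≤ j ∧ τ 31 = d ∧ Agree 30 σ τ ∧
    τ 30 = (σ x) ^ (j - d)) ?_ ?_ ?_ j _ ?_).mono (by omega) ?_
  · rintro τ ⟨-, h, -⟩; exact h
  · rintro d τ ⟨-, h, -⟩; omega
  · rintro d τ ⟨hd, h31, hA, h30⟩
    have e4 : τ 4 = 1 := (hA 4 (by decide)).trans h4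
    have hm : τ 30 * τ x = (σ x) ^ (j - d) := by
      rw [h30, hA x hx, ← pow_succ]; congr 1; omega
    refine .mul_seq ?_ (.sub ⟨by omega, by simp [h31, e4], ?_, ?_⟩)
    · intro _; rw [hm]; exact hpow _ (by omega)
    · repeat' refine Agree.update ?_ (by decide) _
      exact hA
    · simp [hm]
  · refine ⟨le_rfl, by simp [ne_of_lt_thirty hy, hj], ?_, by simp⟩
    repeat' refine Agree.update ?_ (by decide) _
    exact .refl _ _
  · rintro τ ⟨-, -, hA, h⟩
    exact ⟨by simpa using h, hA⟩

/-- Register `30` gets the binomial coefficient of the registers `x` and `y`. -/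
def chooseProg (x y : Fin 40) : Prog 40 :=
  .const 30 1 ;; .const 32 0 ;; .copy 31 y ;; .loop 31
    (.arith .sub 33 x 32 ;; .arith .mul 30 30 33 ;; .arith .add 32 32 4 ;;
      .arith .div 30 30 32 ;; .arith .sub 31 31 4)

/-- The loop follows C(a, i+1) · (i+1) = C(a, i) · (a - i), so every division is exact and no
intermediate product exceeds 2 ^ n · (n + 1). If i reaches a, the truncated factor a - i is zero,
which is the correct value from there on. -/
theorem runs_chooseProg {x y : Fin 40} (hx : x.val < 30) (hy : y.val < 30) {a b n : ℕ}
    {σ : Fin 40 → ℕ} (ha : σ x = a) (hb : σ y = b) (han : a ≤ n) (hbn : b ≤ n)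
    (hn : 2 ^ n * (n + 1) < 2 ^ B) (h4 : σ 4 = 1) :
    Runs O B (chooseProg x y) σ (6 * n + 4) fun τ => τ 30 = a.choose b ∧ Agree 30 σ τ := by
  have hnB : n + 1 < 2 ^ B := lt_of_le_of_lt (Nat.le_mul_of_pos_left _ (by positivity)) hn
  refine .const_seq (by omega) (.const_seq (by omega) (.copy_seq ?_))
  refine (Runs.loop_rounds (N := 5) (fun d τ => d ≤ b ∧ τ 31 = d ∧ Agree 30 σ τ ∧
    τ 32 = b - d ∧ τ 30 = a.choose (b - d)) ?_ ?_ ?_ b _ ?_).mono (by omega) ?_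
  · rintro τ ⟨-, h, -⟩; exact h
  · rintro d τ ⟨-, h, -⟩; omega
  · rintro d τ ⟨hd, h31, hA, h32, h30⟩
    have e4 : τ 4 = 1 := (hA 4 (by decide)).trans h4
    have ex : τ x = a := (hA x hx).trans ha
    have hs : b - d = b - (d + 1) + 1 := by omega
    have hm := Nat.choose_succ_right_eq a (b - (d + 1))
    refine .sub_seq (.mul_seq ?_ (.add_seq ?_ (.div_seq (.sub ⟨by omega, ?_, ?_, ?_, ?_⟩))))
    · intro _
      simp [ex, h32, h30]
      refine lt_of_le_of_lt (Nat.mul_le_mul ?_ (show a - (b - (d + 1)) ≤ n + 1 by omega)) hn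
      exact (Nat.choose_le_two_pow _ _).trans (Nat.pow_le_pow_right (by norm_num) han)
    · intro _
      simp [h32, e4]
      omega
    · simp [h31, e4]
    · repeat' refine Agree.update ?_ (by decide) _
      exact hA
    · simp [h32, e4]; omega
    · simp [h32, e4, ex, h30]
      rw [← hm, hs]
      exact Nat.mul_div_cancel _ (by omega)
  · refine ⟨le_rfl, by simp [ne_of_lt_thirty hy, hb], ?_, by simp, by simp⟩
    repeat' refine Agree.update ?_ (by decide) _
    exact .refl _ _
  · rintro τ ⟨-, -, hA, -, h⟩
    exact ⟨by simpa using h, hA⟩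

/-- Register `30` gets the factorial of register `x`. -/
def factorialProg (x : Fin 40) : Prog 40 :=
  .const 30 1 ;; .copy 31 x ;; .loop 31 (.arith .mul 30 30 31 ;; .arith .sub 31 31 4)

theorem runs_factorialProg {x : Fin 40} (hx : x.val < 30) {k : ℕ} {σ : Fin 40 → ℕ}
    (hB : 1 ≤ B) (hk : σ x = k) (hfac : k.factorial < 2 ^ B) (h4 : σ 4 = 1) :
    Runs O B (factorialProg x) σ (3 * k + 3) fun τ => τ 30 = k.factorial ∧ Agree 30 σ τ := by
  refine .const_seq (Nat.one_lt_two_pow (by omega)) (.copy_seq ?_)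
  -- Factors are multiplied from k downwards, so the product still lacks d!.
  refine (Runs.loop_rounds (N := 2) (fun d τ => τ 31 = d ∧ Agree 30 σ τ ∧
    τ 30 * d.factorial = k.factorial) ?_ ?_ ?_ k _ ?_).mono (by omega) ?_
  · rintro τ ⟨h, -⟩; exact h
  · rintro d τ ⟨h, -⟩; omega
  · rintro d τ ⟨h31, hA, h30⟩
    have e4 : τ 4 = 1 := (hA 4 (by decide)).trans h4
    rw [Nat.factorial_succ, ← mul_assoc] at h30
    refine .mul_seq ?_ (.sub ⟨by simp [h31, e4], ?_, ?_⟩)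
    · intro _
      rw [h31]
      exact lt_of_le_of_lt (Nat.le_mul_of_pos_right _ d.factorial_pos) (h30 ▸ hfac)
    · repeat' refine Agree.update ?_ (by decide) _
      exact hA
    · simpa [h31] using h30
  · refine ⟨by simp [ne_of_lt_thirty hx, hk], ?_, by simp⟩
    repeat' refine Agree.update ?_ (by decide) _
    exact .refl _ _
  · rintro τ ⟨-, hA, h⟩
    exact ⟨by simpa using h, hA⟩

end Subroutines

/-! ### Enumeration of the sets whose union with a given set is small -/

/-- The subset of `{0, …, n - 1}` encoded by a bit mask. -/
def bitSet (n x : ℕ) : Finset (Fin n) := Finset.univ.filter fun i => x.testBit i = true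

@[simp] theorem mem_bitSet {n x : ℕ} {i : Fin n} : i ∈ bitSet n x ↔ x.testBit i = true := by
  simp [bitSet]

/-- For bits x and y, (x + y + 1) / 2 is their disjunction; the recursion then counts the positions
of the union digit by digit. -/
theorem unionCount_eq (n a b : ℕ) :
    unionCount n a b = (bitSet n a ∪ bitSet n b).card := by
  have key : ∀ n a b, unionCount n a b =
      (Finset.univ.filter fun i : Fin n => a.testBit i = true ∨ b.testBit i = true).card := by
    intro n
    induction n with
    | zero => intro a b; simp [unionCount]
    | succ n ih =>
      intro a b
      rw [unionCount, ih, Fin.card_filter_univ_succ]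
      simp only [Fin.val_zero, Fin.val_succ, Nat.testBit_succ, Nat.testBit_zero, decide_eq_true_eq]
      have ha := Nat.mod_two_eq_zero_or_one a
      have hb := Nat.mod_two_eq_zero_or_one b
      rcases ha with ha | ha <;> rcases hb with hb | hb <;> simp [ha, hb] <;> omega
  rw [key]
  congr 1
  ext i
  simp

theorem bitSet_subset_of_lt {n w a i : ℕ} (hi : i < 2 ^ w) :
    bitSet n (2 ^ w * a) ⊆ bitSet n (2 ^ w * a + i) := by
  intro j hj
  rw [mem_bitSet] at hj ⊢
  rw [Nat.two_pow_add_eq_or_of_lt hi, Nat.testBit_or, hj, Bool.true_or]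

/-- The low bits of i fall on zeros of 2 ^ w * a, so the set only grows. This justifies skipping: if
a mask ending in w zeros is rejected, so are all 2 ^ w masks of its block. -/
theorem unionCount_le_of_lt {n w a i y : ℕ} (hi : i < 2 ^ w) :
    unionCount n (2 ^ w * a) y ≤ unionCount n (2 ^ w * a + i) y := by
  rw [unionCount_eq, unionCount_eq]
  exact Finset.card_le_card (Finset.union_subset_union_left (bitSet_subset_of_lt hi))

theorem exists_eq_two_pow_mul_odd {x : ℕ} (hx : x ≠ 0) : ∃ w o, x = 2 ^ w * (2 * o + 1) := by
  obtain ⟨w, m, ⟨o, rfl⟩, h⟩ := Nat.exists_eq_two_pow_mul_odd hx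
  exact ⟨w, o, h⟩

section Enumeration

variable {O : ℕ → Bool} {B : ℕ}

/-- Run `body` for all masks in register `x` whose union with the mask in register `y` has
at most as many elements as register `c` says, in increasing order. -/
def enumProg (x y c go : Fin 40) (body : Prog 40) : Prog 40 :=
  .const x 0 ;; .copy go 3 ;; .loop go
    (unionCountProg x y ;; .arith .sub 31 30 c ;;
      .ite 31 (addLowBit x) (body ;; .arith .add x x 4) ;; .arith .sub go 3 x)

/-- The overhead of one round of `enumProg`. -/
def roundCost (n : ℕ) : ℕ := 21 * n + 20

/-- Amortized analysis of the enumeration. A rejected mask with exactly w trailing zeros is followed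
by one with at least w + 1, so at most n + 1 rounds pass between accepted masks, and each accepted
mask pays for n + 1 rounds. The invariant `I z` speaks of all masks below z as if visited one by
one: `hskip` moves it over rejected masks, and `hstable` says that it ignores the loop's own
registers and the scratch space. -/
theorem runs_enumProg {x y c go : Fin 40} {body : Prog 40}
    (hx : 6 ≤ x.val ∧ x.val < 30) (hgo : 6 ≤ go.val ∧ go.val < 30) (hy : y.val < 30)
    (hc : c.val < 30) (hxgo : x ≠ go)
    {n Y C : ℕ} {cost : ℕ → ℕ} (hB : 2 ^ n + n + 3 < 2 ^ B)
    (I : ℕ → (Fin 40 → ℕ) → Prop)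
    (hstable : ∀ z σ τ, I z σ → (∀ i : Fin 40, i.val < 30 → i ≠ x → i ≠ go → τ i = σ i) → I z τ)
    (hfixed : ∀ z σ, I z σ → σ 0 = n ∧ σ 3 = 2 ^ n ∧ σ 4 = 1 ∧ σ 5 = 2 ∧ σ y = Y ∧ σ c = C)
    (hzero : unionCount n 0 Y ≤ C)
    (hskip : ∀ z σ, z < 2 ^ n → ¬ unionCount n z Y ≤ C → I z σ → I (z + 1) σ)
    (hbody : ∀ z σ, z < 2 ^ n → unionCount n z Y ≤ C → I z σ → σ x = z →
      Runs O B body σ (cost z) fun τ => I (z + 1) τ ∧ τ x = z)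
    {σ : Fin 40 → ℕ} (hI : I 0 σ) :
    Runs O B (enumProg x y c go body) σ
      (∑ z ∈ Finset.range (2 ^ n),
        (if unionCount n z Y ≤ C then cost z + roundCost n * (n + 1) else 0) + 3)
      (I (2 ^ n)) := by
  have hpos : 0 < 2 ^ n := by positivity
  have hxne : ∀ j : Fin 40, j.val < 6 → j ≠ x := by rintro j hj rfl; omega
  have hgone : ∀ j : Fin 40, j.val < 6 → j ≠ go := by rintro j hj rfl; omega
  have hI1 : I 0 (Function.update σ x 0) :=
    hstable _ _ _ hI fun i _ h _ => by simp [h]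
  refine .const_seq (by positivity) (.copy_seq ?_)
  set Φ : ℕ → ℕ := fun a => ∑ z ∈ Finset.Ico a (2 ^ n),
    (if unionCount n z Y ≤ C then cost z + roundCost n * (n + 1) else 0) with hΦ
  -- Here e is the number of masks left, `Φ a` the cost charged to the accepted ones among them, and
  -- `roundCost n * (n - v)` a credit for rejections at a position divisible by 2 ^ v.
  have main : ∀ e a v, a + e = 2 ^ n → v ≤ n → 2 ^ v ∣ a → ∀ τ, I a τ → τ x = a →
      τ go = 2 ^ n - a → Runs O B (.loop go
    (unionCountProg x y ;; .arith .sub 31 30 c ;;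
      .ite 31 (addLowBit x) (body ;; .arith .add x x 4) ;; .arith .sub go 3 x)) τ
        (Φ a + roundCost n * (n - v) + 1) (I (2 ^ n)) := by
    intro e
    induction e using Nat.strong_induction_on with
    | _ e ih =>
    intro a v hae hv hdvd τ hIτ hτx hτgo
    rcases Nat.eq_zero_or_pos e with rfl | he
    · rw [add_zero] at hae
      subst hae
      exact .loop_zero (by simpa using hτgo) hIτ
    obtain ⟨f0, f3, f4, f5, fy, fc⟩ := hfixed _ _ hIτ
    have hgo0 : τ go ≠ 0 := by omega
    have hsub : ∀ b υ, I b υ → υ x = b →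
        Runs O B (.arith .sub go 3 x) υ 1 (fun υ => I b υ ∧ υ x = b ∧ υ go = 2 ^ n - b) := by
      intro b υ hIυ hυx
      refine .sub ⟨hstable _ _ _ hIυ fun i _ _ h => by simp [h], by simp [hxgo, hυx], ?_⟩
      simp [(hfixed _ _ hIυ).2.1, hυx]
    have hunion : Runs O B (unionCountProg x y) τ (14 * n + 5) _ :=
      runs_unionCountProg hx.2 hy (by omega) f0 f4 f5
    have htest : ∀ υ : Fin 40 → ℕ, υ 30 = unionCount n (τ x) (τ y) ∧ Agree 30 τ υ →
        I a (Function.update υ 31 (υ 30 - υ c)) ∧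
        (Function.update υ 31 (υ 30 - υ c)) x = a ∧
        (Function.update υ 31 (υ 30 - υ c)) 31 = unionCount n a Y - C := by
      rintro υ ⟨h30, hA⟩
      refine ⟨hstable _ _ _ hIτ fun i hi _ _ => ?_, ?_, ?_⟩
      · simpa [ne_of_lt_thirty hi] using hA i hi
      · simpa [ne_of_lt_thirty hx.2, hτx] using hA x hx.2
      · simp [h30, hA c hc, hτx, fy, fc]
    by_cases hval : unionCount n a Y ≤ C
    · have hΦa : Φ a = cost a + roundCost n * (n + 1) + Φ (a + 1) := by
        rw [hΦ]
        simp only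
        rw [Finset.sum_eq_sum_Ico_succ_bot (by omega), if_pos hval]
      have hnext := ih (e - 1) (by omega) (a + 1) 0 (by omega) (by omega) (by simp)
      refine (Runs.loop_pos hgo0 (N := 14 * n + 5 + ((cost a + 1) + 1 + 1 + 1)) (hunion.seq
        fun υ hυ => .sub_seq (.mono (N := cost a + 1 + 1 + 1) ?_ (by omega) fun _ h => h))
        (Q := fun υ => I (a + 1) υ ∧ υ x = a + 1 ∧ υ go = 2 ^ n - (a + 1))
        fun υ hυ => hnext υ hυ.1 hυ.2.1 hυ.2.2).mono ?_ fun _ h => h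
      · obtain ⟨t1, t2, t3⟩ := htest υ hυ
        refine (Runs.ite (N := cost a + 1) (Q := fun υ => I (a + 1) υ ∧ υ x = a + 1)
          (fun h => absurd t3 (by omega)) fun _ => ?_).seq
          fun υ hυ => hsub _ υ hυ.1 hυ.2
        refine (hbody a _ (by omega) hval t1 t2).seq fun ρ hρ => ?_
        have e4 := (hfixed _ _ hρ.1).2.2.1
        refine .add (fun _ => by rw [hρ.2, e4]; omega) ⟨?_, by simp [hρ.2, e4]⟩
        exact hstable _ _ _ hρ.1 fun i _ h _ => by simp [h]
      · rw [hΦa]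
        simp only [roundCost, Nat.sub_zero]
        nlinarith [Nat.zero_le ((21 * n + 20) * (n - v))]
    · have ha0 : a ≠ 0 := by rintro rfl; exact hval hzero
      obtain ⟨w, o, hw⟩ := exists_eq_two_pow_mul_odd ha0
      have hvw : v ≤ w := by
        rw [hw] at hdvd
        have hcop : Nat.Coprime (2 ^ v) (2 * o + 1) :=
          Nat.Coprime.pow_left _ (by simp)
        exact (Nat.pow_dvd_pow_iff_le_right (by norm_num)).1 (hcop.dvd_of_dvd_mul_right hdvd)
      have hwn : w < n := by
        by_contra hcon
        have : 2 ^ n ≤ 2 ^ w := Nat.pow_le_pow_right (by norm_num) (by omega)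
        nlinarith [Nat.zero_le (2 ^ w * o)]
      have hle : 2 ^ w * (2 * o + 2) ≤ 2 ^ n := by
        obtain ⟨u, rfl⟩ := Nat.exists_eq_add_of_lt hwn
        have h2 : 2 ^ (w + u + 1) = 2 ^ w * (2 * 2 ^ u) := by ring
        have hlt : a < 2 ^ (w + u + 1) := by omega
        rw [h2, hw] at hlt
        rw [h2]
        have := Nat.lt_of_mul_lt_mul_left hlt
        exact Nat.mul_le_mul_left _ (by omega)
      have hadd : 2 ^ w * (2 * o + 2) = a + 2 ^ w := by rw [hw]; ring
      have hinv : ∀ i < 2 ^ w, ¬ unionCount n (a + i) Y ≤ C := by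
        intro i hi
        rw [hw] at hval ⊢
        have := unionCount_le_of_lt (n := n) (a := 2 * o + 1) (y := Y) hi
        omega
      -- The program jumps over the block at once, whereas the invariant crosses it mask by mask.
      have hIskip : ∀ i ≤ 2 ^ w, ∀ υ, I a υ → I (a + i) υ := by
        intro i
        induction i with
        | zero => exact fun _ _ h => h
        | succ i ihi =>
          exact fun hi υ h => hskip (a + i) υ (by omega) (hinv i (by omega)) (ihi (by omega) υ h)
      have hΦa : Φ (a + 2 ^ w) ≤ Φ a := Finset.sum_le_sum_of_subset
        (Finset.Ico_subset_Ico_left (Nat.le_add_right _ _))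
      have hwpos : 0 < 2 ^ w := by positivity
      -- The new position is divisible by 2 ^ (w + 1) with w ≥ v, so the credit falls by at least
      -- one round.
      have hnext := ih (e - 2 ^ w) (by omega) (a + 2 ^ w) (w + 1) (by omega) (by omega)
        (by rw [← hadd]; exact ⟨o + 1, by ring⟩)
      refine (Runs.loop_pos hgo0 (N := 14 * n + 5 + ((7 * n + 8) + 1 + 1 + 1)) (hunion.seq
        fun υ hυ => .sub_seq (.mono (N := (7 * n + 8) + 1 + 1) ?_ (by omega) fun _ h => h))
        (Q := fun υ => I (a + 2 ^ w) υ ∧ υ x = a + 2 ^ w ∧ υ go = 2 ^ n - (a + 2 ^ w))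
        fun υ hυ => hnext υ hυ.1 hυ.2.1 hυ.2.2).mono ?_ fun _ h => h
      · obtain ⟨t1, t2, t3⟩ := htest υ hυ
        refine (Runs.ite (N := 7 * n + 8) (Q := fun υ => I (a + 2 ^ w) υ ∧ υ x = a + 2 ^ w)
          (fun _ => ?_) (fun h => absurd t3 (by omega))).seq
          fun υ hυ => hsub _ υ hυ.1 hυ.2
        obtain ⟨-, -, g4, g5, -⟩ := hfixed _ _ t1
        refine (runs_addLowBit hx.2 (n := n) (v := w) (o := o) (by omega) ?_ (t2.trans hw)
          (by omega) g4 g5).mono le_rfl fun ρ hρ => ⟨?_, by omega⟩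
        · rcases B with _ | B
          · simp at hB
          · omega
        · exact hstable _ _ _ (hIskip _ le_rfl _ t1) fun i hi h _ => hρ.2 i hi h
      · have hs : roundCost n * (n - v) ≥ roundCost n * (n - (w + 1)) + roundCost n := by
          rw [← Nat.mul_succ]
          exact Nat.mul_le_mul_left _ (by omega)
        simp only [roundCost] at hs ⊢
        omega
  have e3 := (hfixed _ _ hI1).2.1
  -- At the start v = n is allowed, since 2 ^ n divides 0; no initial credit is needed.
  refine ((main (2 ^ n) 0 n (by omega) le_rfl (by simp) _ ?_ ?_ ?_).mono (N' := ?_) ?_ fun _ h => h)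
  · exact hstable _ _ _ hI1 fun i _ _ h => by simp [h]
  · simp [hxgo]
  · simp [e3]
  · rw [hΦ]
    simp only [← Finset.range_eq_Ico, Nat.sub_self, mul_zero, add_zero]
    exact le_rfl

end Enumeration

/-! ### Counting packings by inclusion and exclusion -/

section Counting

open Finset

/-! ### Growth of the terms in the cost bound. -/

/-- The quotient of consecutive terms is 5 (n - q) / (q + 1), which is at least 1 throughout this
range. -/
theorem choose_mul_five_pow_mono {n q u : ℕ} (hq : 3 * q ≤ 2 * n) (hu : u ≤ q) :
    n.choose u * 5 ^ u ≤ n.choose q * 5 ^ q := by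
  induction q, hu using Nat.le_induction with
  | base => exact le_rfl
  | succ q _ ih =>
    refine (ih (by omega)).trans ?_
    have h := Nat.choose_succ_right_eq n q
    have h2 : q + 1 ≤ 5 * (n - q) := by omega
    refine Nat.le_of_mul_le_mul_right (c := q + 1) ?_ (by omega)
    calc n.choose q * 5 ^ q * (q + 1) ≤ n.choose q * 5 ^ q * (5 * (n - q)) :=
          Nat.mul_le_mul_left _ h2
      _ = n.choose q * (n - q) * 5 ^ (q + 1) := by ring
      _ = n.choose (q + 1) * 5 ^ (q + 1) * (q + 1) := by rw [← h]; ring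

/-- Needed for k = 1, where q = m may exceed 2n/3 and the previous monotonicity is unavailable.
There no powers of 5 occur on the left, and counting pairs of a u-set inside a q-set in two ways
suffices. -/
theorem choose_le_choose_mul_two_pow {n q u : ℕ} (hq : q ≤ n) (hu : u ≤ q) :
    n.choose u ≤ n.choose q * 2 ^ q := by
  calc n.choose u ≤ n.choose u * (n - u).choose (q - u) :=
        Nat.le_mul_of_pos_right _ (Nat.choose_pos (by omega))
    _ = n.choose q * q.choose u := (Nat.choose_mul hu).symm
    _ ≤ n.choose q * 2 ^ q := Nat.mul_le_mul_left _ (Nat.choose_le_two_pow _ _)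

/-! ### Tuples of members and their unions. -/

variable {α : Type*} [DecidableEq α]

/-- The union of a tuple of sets. -/
def unionOf {j : ℕ} (t : Fin j → Finset α) : Finset α := univ.biUnion t

/-- The `j`-tuples of members of `F`. -/
def tuples (F : Finset (Finset α)) (j : ℕ) : Finset (Fin j → Finset α) :=
  Fintype.piFinset fun _ => F

/-- The number of members of `F` inside `S`. -/
def below (F : Finset (Finset α)) (S : Finset α) : ℕ := (F.filter (· ⊆ S)).card

/-- The number of `j`-tuples of members of `F` whose union has `q` elements and contains `X`. -/
def covering (F : Finset (Finset α)) (j q : ℕ) (X : Finset α) : ℕ :=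
  ((tuples F j).filter fun t => (unionOf t).card = q ∧ X ⊆ unionOf t).card

theorem unionOf_subset_iff {j : ℕ} {t : Fin j → Finset α} {S : Finset α} :
    unionOf t ⊆ S ↔ ∀ i, t i ⊆ S := by
  simp [unionOf]

theorem below_pow (F : Finset (Finset α)) (S : Finset α) (j : ℕ) :
    below F S ^ j = ((tuples F j).filter fun t => unionOf t ⊆ S).card := by
  have : (tuples F j).filter (fun t => unionOf t ⊆ S) =
      Fintype.piFinset fun _ : Fin j => F.filter (· ⊆ S) := by
    ext t
    simp only [tuples, mem_filter, Fintype.mem_piFinset, unionOf_subset_iff]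
    exact ⟨fun h i => ⟨h.1 i, h.2 i⟩, fun h => ⟨fun i => (h i).1, fun i => (h i).2⟩⟩
  rw [this, Fintype.card_piFinset]
  simp [below]

theorem card_unionOf_le {F : Finset (Finset α)} {m : ℕ} (hF : ∀ A ∈ F, A.card = m) {j : ℕ}
    {t : Fin j → Finset α} (ht : t ∈ tuples F j) : (unionOf t).card ≤ m * j := by
  rw [tuples, Fintype.mem_piFinset] at ht
  refine card_biUnion_le.trans ?_
  simp [hF _ (ht _), mul_comm]

theorem unionOf_append {j j' : ℕ} (t : Fin j → Finset α) (t' : Fin j' → Finset α) :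
    unionOf (Fin.append t t') = unionOf t ∪ unionOf t' := by
  ext a
  simp only [unionOf, mem_biUnion, mem_univ, true_and, mem_union]
  constructor
  · rintro ⟨i, hi⟩
    induction i using Fin.addCases with
    | left i => exact Or.inl ⟨i, by simpa using hi⟩
    | right i => exact Or.inr ⟨i, by simpa using hi⟩
  · rintro (⟨i, hi⟩ | ⟨i, hi⟩)
    · exact ⟨Fin.castAdd j' i, by simpa using hi⟩
    · exact ⟨Fin.natAdd j i, by simpa using hi⟩

theorem cast_card_filter {β : Type*} (s : Finset β) (p : β → Prop) [DecidablePred p] :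
    ((s.filter p).card : ℤ) = ∑ b ∈ s, if p b then (1 : ℤ) else 0 := by
  rw [card_filter]
  push_cast
  rfl

/-- Concatenation is the bijection. Backwards, the two halves have unions of at most mj and mj'
elements, so a union of m(j + j') elements forces both bounds to be attained and the overlap to be
empty. -/
theorem card_tuples_append {F : Finset (Finset α)} {m : ℕ} (hF : ∀ A ∈ F, A.card = m)
    (j j' : ℕ) :
    ((tuples F j ×ˢ tuples F j').filter fun p => (unionOf p.1).card = m * j ∧
      (unionOf p.2).card = m * j' ∧ Disjoint (unionOf p.1) (unionOf p.2)).card =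
    ((tuples F (j + j')).filter fun t => (unionOf t).card = m * (j + j')).card := by
  refine card_nbij' (fun p => Fin.append p.1 p.2)
    (fun t => (fun i => t (Fin.castAdd j' i), fun i => t (Fin.natAdd j i))) ?_ ?_ ?_ ?_
  · rintro ⟨t, t'⟩ hp
    simp only [coe_filter, mem_product, Set.mem_ofPred_eq] at hp ⊢
    obtain ⟨⟨ht, ht'⟩, h1, h2, h3⟩ := hp
    refine ⟨?_, ?_⟩
    · simp only [tuples, Fintype.mem_piFinset] at ht ht' ⊢
      intro i
      induction i using Fin.addCases with
      | left i => simpa using ht i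
      | right i => simpa using ht' i
    · rw [unionOf_append, card_union_of_disjoint h3, h1, h2, mul_add]
  · intro t ht
    simp only [coe_filter, mem_product, Set.mem_ofPred_eq] at ht ⊢
    obtain ⟨ht, h⟩ := ht
    have ht1 : (fun i => t (Fin.castAdd j' i)) ∈ tuples F j := by
      simp only [tuples, Fintype.mem_piFinset] at ht ⊢
      exact fun i => ht _
    have ht2 : (fun i => t (Fin.natAdd j i)) ∈ tuples F j' := by
      simp only [tuples, Fintype.mem_piFinset] at ht ⊢
      exact fun i => ht _
    have h1 := card_unionOf_le hF ht1
    have h2 := card_unionOf_le hF ht2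
    have e := unionOf_append (fun i => t (Fin.castAdd j' i)) (fun i => t (Fin.natAdd j i))
    rw [Fin.append_castAdd_natAdd] at e
    have h3 := card_union_add_card_inter (unionOf fun i => t (Fin.castAdd j' i))
      (unionOf fun i => t (Fin.natAdd j i))
    rw [e, mul_add] at h
    refine ⟨⟨ht1, ht2⟩, by omega, by omega, ?_⟩
    rw [disjoint_iff_inter_eq_empty, ← card_eq_zero]
    omega
  · rintro ⟨t, t'⟩ _
    simp
  · intro t _
    exact Fin.append_castAdd_natAdd

/-- The size mk is the maximum allowed by the union bound. Separating one entry from the other k -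
1, whose union has at most m(k - 1) elements, shows that equality leaves no room for an
intersection. -/
theorem card_unionOf_eq_iff {F : Finset (Finset α)} {m : ℕ} (hF : ∀ A ∈ F, A.card = m) {k : ℕ}
    {t : Fin k → Finset α} (ht : t ∈ tuples F k) :
    (unionOf t).card = m * k ↔ ∀ i i', i ≠ i' → Disjoint (t i) (t i') := by
  have ht' : ∀ i, (t i).card = m := fun i => hF _ (Fintype.mem_piFinset.1 ht i)
  constructor
  · intro h i i' hi
    have e : unionOf t = t i ∪ (univ.erase i).biUnion t := by
      rw [unionOf, ← biUnion_insert, insert_erase (mem_univ i)]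
    have h1 : ((univ.erase i).biUnion t).card ≤ m * (k - 1) := by
      refine card_biUnion_le.trans ?_
      simp [ht', card_erase_of_mem, mul_comm]
    have h2 := card_union_add_card_inter (t i) ((univ.erase i).biUnion t)
    have h3 : m * k = m + m * (k - 1) := by
      obtain ⟨l, rfl⟩ := Nat.exists_eq_add_of_lt (Nat.zero_lt_of_lt i.isLt)
      simp only [Nat.add_sub_cancel]
      ring
    rw [← e, h, ht'] at h2
    have h4 : Disjoint (t i) ((univ.erase i).biUnion t) := by
      rw [disjoint_iff_inter_eq_empty, ← card_eq_zero]
      omega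
    exact disjoint_of_subset_right (subset_biUnion_of_mem t (by simp [hi.symm])) h4
  · intro h
    rw [unionOf, card_biUnion fun i _ i' _ hi => h i i' hi]
    simp [ht', mul_comm]

/-- A k-tuple whose image is a set of k elements is a bijection from the indices onto that set. -/
theorem card_filter_image_eq {k : ℕ} (P : Finset (Finset α)) (hP : P.card = k) :
    ((tuples P k).filter fun t => univ.image t = P).card = k.factorial := by
  have e : Fin k ≃ P := (Fintype.equivFinOfCardEq (by simpa using hP)).symm
  have hfac : k.factorial = (univ : Finset (Fin k ≃ P)).card := by
    rw [card_univ, Fintype.card_equiv e, Fintype.card_fin]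
  rw [hfac]
  symm
  refine card_bij (fun f _ i => (f i : Finset α)) ?_ ?_ ?_
  · intro f _
    simp only [tuples, mem_filter, Fintype.mem_piFinset]
    refine ⟨fun i => (f i).2, ?_⟩
    ext A
    simp only [mem_image, mem_univ, true_and]
    exact ⟨by rintro ⟨i, rfl⟩; exact (f i).2, fun hA => ⟨f.symm ⟨A, hA⟩, by simp⟩⟩
  · intro f _ g _ h
    ext i : 2
    exact congrFun h i
  · intro t ht
    simp only [tuples, mem_filter, Fintype.mem_piFinset] at ht
    have hsurj : Function.Surjective fun i => (⟨t i, ht.1 i⟩ : P) := by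
      rintro ⟨A, hA⟩
      rw [← ht.2] at hA
      obtain ⟨i, -, hi⟩ := mem_image.1 hA
      exact ⟨i, Subtype.ext hi⟩
    have hbij := (Fintype.bijective_iff_surjective_and_card _).2
      ⟨hsurj, by simp [hP]⟩
    exact ⟨Equiv.ofBijective _ hbij, mem_univ _, rfl⟩

/-- The tuples are grouped by their image, each packing having k! orderings. The condition m ≥ 1
rules out repetitions: a repeated entry would be disjoint from itself, hence empty. -/
theorem card_disjoint_tuples {F : Finset (Finset α)} {m : ℕ} (hF : ∀ A ∈ F, A.card = m)
    (hm : 1 ≤ m) (k : ℕ) :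
    ((tuples F k).filter fun t => (unionOf t).card = m * k).card =
      k.factorial * ((F.powersetCard k).filter fun P =>
        ∀ A ∈ P, ∀ B ∈ P, A ≠ B → Disjoint A B).card := by
  have hinj : ∀ t ∈ tuples F k, (unionOf t).card = m * k → Function.Injective t := by
    intro t ht h i i' hi
    by_contra hne
    have h1 := (card_unionOf_eq_iff hF ht).1 h i i' hne
    rw [← hi, disjoint_self_iff_empty] at h1
    have h2 := hF _ (Fintype.mem_piFinset.1 ht i)
    rw [h1, card_empty] at h2
    omega
  rw [card_eq_sum_card_fiberwise (f := fun t => univ.image t)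
    (t := (F.powersetCard k).filter fun P => ∀ A ∈ P, ∀ B ∈ P, A ≠ B → Disjoint A B)]
  · rw [sum_congr rfl (g := fun _ => k.factorial), sum_const, smul_eq_mul, mul_comm]
    intro P hP
    simp only [mem_filter, mem_powersetCard] at hP
    obtain ⟨⟨hPF, hPk⟩, hPd⟩ := hP
    rw [← card_filter_image_eq P hPk]
    congr 1
    ext t
    simp only [mem_filter]
    constructor
    · rintro ⟨⟨ht, -⟩, h⟩
      refine ⟨Fintype.mem_piFinset.2 fun i => ?_, h⟩
      rw [← h]
      exact mem_image_of_mem t (mem_univ i)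
    · rintro ⟨ht, h⟩
      have htF : t ∈ tuples F k :=
        Fintype.mem_piFinset.2 fun i => hPF (Fintype.mem_piFinset.1 ht i)
      refine ⟨⟨htF, (card_unionOf_eq_iff hF htF).2 fun i i' hi => ?_⟩, h⟩
      have hti : Function.Injective t := by
        have : Set.InjOn t (univ : Finset (Fin k)) := by
          rw [← card_image_iff, h, hPk, card_univ, Fintype.card_fin]
        simpa using this
      exact hPd _ (Fintype.mem_piFinset.1 ht i) _ (Fintype.mem_piFinset.1 ht i')
        fun hc => hi (hti hc)
  · intro t ht
    simp only [coe_filter, Set.mem_ofPred_eq, mem_powersetCard] at ht ⊢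
    obtain ⟨ht, h⟩ := ht
    refine ⟨⟨?_, ?_⟩, ?_⟩
    · intro A hA
      obtain ⟨i, -, rfl⟩ := mem_image.1 hA
      exact Fintype.mem_piFinset.1 ht i
    · rw [card_image_of_injective _ (hinj t ht h), card_univ, Fintype.card_fin]
    · intro A hA A' hA' hne
      obtain ⟨i, -, rfl⟩ := mem_image.1 hA
      obtain ⟨i', -, rfl⟩ := mem_image.1 hA'
      exact (card_unionOf_eq_iff hF ht).1 h i i' fun hc => hne (by rw [hc])

/-! ### Alternating sums over the subsets of a finite type. -/

variable [Fintype α]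

/-- With T ⊆ Y, the sets in between are T ∪ Z with Z ⊆ Y \ T, and the signs over the subsets of a
nonempty set cancel. -/
theorem sum_neg_one_pow_card_between (T Y : Finset α) :
    (∑ S : Finset α, if T ⊆ S ∧ S ⊆ Y then (-1 : ℤ) ^ S.card else 0) =
      if T = Y then (-1) ^ Y.card else 0 := by
  rw [← sum_filter]
  by_cases h : T ⊆ Y
  · have e : univ.filter (fun S => T ⊆ S ∧ S ⊆ Y) = (Y \ T).powerset.image (T ∪ ·) := by
      rw [← Icc_eq_image_powerset h]
      ext S
      simp
    have hdisj : ∀ {Z}, Z ⊆ Y \ T → Disjoint T Z := fun hZ =>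
      disjoint_of_subset_right hZ disjoint_sdiff
    rw [e, sum_image]
    · calc ∑ Z ∈ (Y \ T).powerset, (-1 : ℤ) ^ (T ∪ Z).card
          = ∑ Z ∈ (Y \ T).powerset, (-1 : ℤ) ^ T.card * (-1) ^ Z.card := by
            refine sum_congr rfl fun Z hZ => ?_
            rw [card_union_of_disjoint (hdisj (mem_powerset.1 hZ)), pow_add]
        _ = _ := by
            rw [← mul_sum, sum_powerset_neg_one_pow_card]
            by_cases hTY : T = Y
            · subst hTY; simp
            · have : Y \ T ≠ ∅ := fun h' => hTY (h.antisymm (sdiff_eq_empty_iff_subset.1 h'))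
              simp [this, hTY]
    · intro Z hZ Z' hZ' hZZ
      have h1 := hdisj (mem_powerset.1 hZ)
      have h2 := hdisj (mem_powerset.1 hZ')
      have : (T ∪ Z) \ T = (T ∪ Z') \ T := congrArg (· \ T) hZZ
      rwa [union_sdiff_cancel_left h1, union_sdiff_cancel_left h2] at this
  · rw [if_neg (by rintro rfl; exact h Subset.rfl)]
    refine sum_eq_zero fun S hS => absurd ?_ h
    exact (mem_filter.1 hS).2.1.trans (mem_filter.1 hS).2.2

theorem card_supersets (U : Finset α) {q : ℕ} (hq : q ≤ Fintype.card α) :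
    (univ.filter fun Y : Finset α => U ⊆ Y ∧ Y.card = q).card =
      (Fintype.card α - U.card).choose (Fintype.card α - q) := by
  rw [← card_compl, ← card_powersetCard]
  refine card_nbij' (fun Y => Yᶜ) (fun Y => Yᶜ) ?_ ?_ ?_ ?_
  · intro Y hY
    simp only [coe_filter, mem_univ, true_and, Set.mem_ofPred_eq] at hY
    simp [mem_powersetCard, card_compl, hY.1, hY.2]
  · intro Y hY
    simp only [mem_coe, mem_powersetCard] at hY
    have := card_compl_add_card Y
    simp only [coe_filter, mem_univ, true_and, Set.mem_ofPred_eq]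
    exact ⟨subset_compl_comm.1 hY.1, by omega⟩
  · intro Y _; simp
  · intro Y _; simp

/-- The binomial coefficient counts the q-sets Y ⊇ X ∪ S, and the power counts the tuples with union
inside S. After exchanging sums, S runs between the union and Y, and only tuples whose union equals
Y survive. -/
theorem sum_choose_mul_below_pow (F : Finset (Finset α)) {j q Q : ℕ} (hqQ : q ≤ Q)
    (hq : q ≤ Fintype.card α) (X : Finset α) :
    (∑ S : Finset α, if (X ∪ S).card ≤ Q then (-1 : ℤ) ^ S.card *
      (((Fintype.card α - (X ∪ S).card).choose (Fintype.card α - q) * below F S ^ j : ℕ) : ℤ)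
      else 0) = (-1) ^ q * covering F j q X := by
  have drop : ∀ S : Finset α, (if (X ∪ S).card ≤ Q then (-1 : ℤ) ^ S.card *
      (((Fintype.card α - (X ∪ S).card).choose (Fintype.card α - q) * below F S ^ j : ℕ) : ℤ)
      else 0) = ∑ Y : Finset α, ∑ t ∈ tuples F j, if (X ⊆ Y ∧ Y.card = q) ∧
        (unionOf t ⊆ S ∧ S ⊆ Y) then (-1 : ℤ) ^ S.card else 0 := by
    intro S
    have e : (-1 : ℤ) ^ S.card *
        (((Fintype.card α - (X ∪ S).card).choose (Fintype.card α - q) * below F S ^ j : ℕ) : ℤ) =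
        ∑ Y : Finset α, ∑ t ∈ tuples F j, if (X ⊆ Y ∧ Y.card = q) ∧
        (unionOf t ⊆ S ∧ S ⊆ Y) then (-1 : ℤ) ^ S.card else 0 := by
      rw [← card_supersets _ hq, below_pow]
      push_cast
      rw [cast_card_filter, cast_card_filter, sum_mul_sum, mul_sum]
      refine sum_congr rfl fun Y _ => ?_
      rw [mul_sum]
      refine sum_congr rfl fun t _ => ?_
      simp only [union_subset_iff]
      split_ifs <;> simp_all
    by_cases h : (X ∪ S).card ≤ Q
    · rw [if_pos h, e]
    -- Beyond Q ≥ q no q-set contains X ∪ S, so the cutoff loses nothing. This permits one Q, and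
    -- thus one enumeration, to serve both tuple lengths.
    · rw [if_neg h, ← e, Nat.choose_eq_zero_of_lt, zero_mul, Nat.cast_zero, mul_zero]
      have := card_le_univ (X ∪ S)
      omega
  rw [sum_congr rfl fun S _ => drop S, sum_comm]
  calc ∑ Y : Finset α, ∑ S : Finset α, ∑ t ∈ tuples F j, (if (X ⊆ Y ∧ Y.card = q) ∧
        (unionOf t ⊆ S ∧ S ⊆ Y) then (-1 : ℤ) ^ S.card else 0)
      = ∑ Y : Finset α, ∑ t ∈ tuples F j,
          if (X ⊆ Y ∧ Y.card = q) ∧ unionOf t = Y then (-1 : ℤ) ^ q else 0 := by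
        refine sum_congr rfl fun Y _ => ?_
        rw [sum_comm]
        refine sum_congr rfl fun t _ => ?_
        by_cases h : X ⊆ Y ∧ Y.card = q
        · simp only [h, and_self, true_and]
          rw [sum_neg_one_pow_card_between, h.2]
        · simp [h]
    _ = ∑ t ∈ tuples F j, if (unionOf t).card = q ∧ X ⊆ unionOf t then (-1 : ℤ) ^ q else 0 := by
        rw [sum_comm]
        refine sum_congr rfl fun t _ => ?_
        rw [sum_eq_single (unionOf t)]
        · simp [and_comm]
        · intro Y _ hY
          simp [hY.symm]
        · simp
    _ = _ := by
        rw [← sum_filter, sum_const, covering, nsmul_eq_mul, mul_comm]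

/-- For a pair of tuples, X runs over the subsets of the intersection of the two unions, so the
signs cancel unless that intersection is empty. The cutoff is harmless because X lies in a union of
q ≤ Q elements. -/
theorem sum_covering_mul_covering (F : Finset (Finset α)) {j j' q q' Q : ℕ} (hq : q ≤ Q) :
    (∑ X : Finset α, if X.card ≤ Q then
      (-1 : ℤ) ^ X.card * ((covering F j q X * covering F j' q' X : ℕ) : ℤ) else 0) =
      (((tuples F j ×ˢ tuples F j').filter fun p => (unionOf p.1).card = q ∧
        (unionOf p.2).card = q' ∧ Disjoint (unionOf p.1) (unionOf p.2)).card : ℤ) := by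
  have e : ∀ X : Finset α, (if X.card ≤ Q then
      (-1 : ℤ) ^ X.card * ((covering F j q X * covering F j' q' X : ℕ) : ℤ) else 0) =
      ∑ p ∈ tuples F j ×ˢ tuples F j', if ((unionOf p.1).card = q ∧ (unionOf p.2).card = q') ∧
        (∅ ⊆ X ∧ X ⊆ unionOf p.1 ∩ unionOf p.2) then (-1 : ℤ) ^ X.card else 0 := by
    intro X
    rw [sum_product]
    split_ifs with h
    · unfold covering
      push_cast
      rw [cast_card_filter, cast_card_filter, sum_mul_sum, mul_sum]
      refine sum_congr rfl fun t _ => ?_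
      rw [mul_sum]
      refine sum_congr rfl fun t' _ => ?_
      simp only [subset_inter_iff]
      split_ifs <;> simp_all
    · symm
      refine sum_eq_zero fun t _ => sum_eq_zero fun t' _ => if_neg ?_
      rintro ⟨⟨h1, -⟩, -, h2⟩
      have := card_le_card (h2.trans inter_subset_left)
      omega
  rw [sum_congr rfl fun X _ => e X, sum_comm, cast_card_filter]
  refine sum_congr rfl fun p _ => ?_
  by_cases h : (unionOf p.1).card = q ∧ (unionOf p.2).card = q'
  · simp only [h, and_self, true_and]
    have := sum_neg_one_pow_card_between (∅ : Finset α) (unionOf p.1 ∩ unionOf p.2)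
    simp only [this, disjoint_iff_inter_eq_empty]
    by_cases h' : unionOf p.1 ∩ unionOf p.2 = ∅
    · simp [h']
    · rw [if_neg (Ne.symm h'), if_neg h']
  · rw [not_and_or] at h
    rcases h with h | h <;> simp [h]

theorem sum_alternating_covering {F : Finset (Finset α)} {m : ℕ} (hF : ∀ A ∈ F, A.card = m)
    (hm : 1 ≤ m) {j j' Q : ℕ} (hQ : m * j ≤ Q) :
    (∑ X : Finset α, if X.card ≤ Q then (-1 : ℤ) ^ X.card *
      ((covering F j (m * j) X * covering F j' (m * j') X : ℕ) : ℤ) else 0) =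
      ((j + j').factorial * ((F.powersetCard (j + j')).filter fun P =>
        ∀ A ∈ P, ∀ B ∈ P, A ≠ B → Disjoint A B).card : ℕ) := by
  rw [sum_covering_mul_covering F hQ, card_tuples_append hF, card_disjoint_tuples hF hm]
  congr!

/-! ### The size of the search space -/

/-- Given S ⊆ U, the set X must contain U \ S and is free on S, giving 2^|S| choices. With the
weight this is 4^|S|, and the binomial theorem sums it to (4 + 1)^|U|. -/
theorem sum_two_pow_card_of_union_eq (U : Finset α) :
    (∑ X : Finset α, ∑ S : Finset α, if X ∪ S = U then 2 ^ S.card else 0) = 5 ^ U.card := by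
  rw [sum_comm]
  have inner : ∀ S : Finset α, (∑ X : Finset α, if X ∪ S = U then 2 ^ S.card else 0) =
      if S ⊆ U then 4 ^ S.card else 0 := by
    intro S
    rw [← sum_filter, sum_const, smul_eq_mul]
    split_ifs with h
    · have e : (univ.filter fun X => X ∪ S = U) = S.powerset.image (U \ S ∪ ·) := by
        ext X
        simp only [mem_filter, mem_univ, true_and, mem_image, mem_powerset]
        constructor
        · rintro rfl
          refine ⟨X ∩ S, inter_subset_right, ?_⟩
          ext a
          simp only [mem_union, mem_sdiff, mem_inter]
          tauto
        · rintro ⟨Z, hZ, rfl⟩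
          rw [union_assoc, union_eq_right.2 hZ, sdiff_union_of_subset h]
      rw [e, card_image_of_injOn, card_powerset, ← mul_pow]
      · norm_num
      intro Z hZ Z' hZ' hZZ
      have h1 : Disjoint (U \ S) Z :=
        disjoint_of_subset_right (mem_powerset.1 hZ) sdiff_disjoint
      have h2 : Disjoint (U \ S) Z' :=
        disjoint_of_subset_right (mem_powerset.1 hZ') sdiff_disjoint
      have : (U \ S ∪ Z) \ (U \ S) = (U \ S ∪ Z') \ (U \ S) := congrArg (· \ (U \ S)) hZZ
      rwa [union_sdiff_cancel_left h1, union_sdiff_cancel_left h2] at this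
    · rw [card_eq_zero.2, zero_mul]
      refine filter_eq_empty_iff.2 fun X _ hX => h ?_
      rw [← hX]
      exact subset_union_right
  rw [sum_congr rfl fun S _ => inner S, ← sum_filter]
  have e : (univ.filter fun S => S ⊆ U) = U.powerset := by ext; simp
  have := sum_pow_mul_eq_add_pow 4 1 U
  simpa [e] using this

theorem sum_two_pow_card_of_union_le (q : ℕ) :
    (∑ X : Finset α, ∑ S : Finset α, if (X ∪ S).card ≤ q then 2 ^ S.card else 0) =
      ∑ u ∈ range (q + 1), (Fintype.card α).choose u * 5 ^ u := by
  have h : ∀ X S : Finset α, (if (X ∪ S).card ≤ q then 2 ^ S.card else 0) =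
      ∑ U : Finset α, if U.card ≤ q then (if X ∪ S = U then 2 ^ S.card else 0) else 0 := by
    intro X S
    rw [sum_eq_single (X ∪ S)]
    · simp
    · intro U _ hU
      simp [hU.symm]
    · simp
  simp only [h]
  rw [sum_congr rfl fun X _ => sum_comm, sum_comm]
  have h2 : ∀ U : Finset α, (∑ X : Finset α, ∑ S : Finset α,
      if U.card ≤ q then (if X ∪ S = U then 2 ^ S.card else 0) else 0) =
      ∑ u ∈ range (q + 1), if U.card = u then 5 ^ u else 0 := by
    intro U
    split_ifs with hU
    · rw [sum_two_pow_card_of_union_eq, sum_ite_eq, if_pos (by simp; omega)]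
    · rw [sum_ite_eq, if_neg (by simp; omega)]
      simp
  rw [sum_congr rfl fun U _ => h2 U, sum_comm]
  refine sum_congr rfl fun u _ => ?_
  rw [← sum_filter, sum_const, smul_eq_mul, ← powerset_univ, ← powersetCard_eq_filter,
    card_powersetCard, card_univ]

end Counting

/-! ### Bit masks -/

section Masks

open Finset

theorem sum_two_pow_map {n : ℕ} (A : Finset (Fin n)) :
    mask A = ∑ i ∈ A.map Fin.valEmbedding, 2 ^ i := by
  simp [mask]

@[simp] theorem bitSet_mask {n : ℕ} (A : Finset (Fin n)) : bitSet n (mask A) = A := by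
  ext i
  rw [mem_bitSet, ← Nat.mem_bitIndices, ← List.mem_toFinset, sum_two_pow_map,
    toFinset_bitIndices_sum_two_pow]
  simp [← Fin.ext_iff]

theorem mask_lt {n : ℕ} (A : Finset (Fin n)) : mask A < 2 ^ n := by
  rw [sum_two_pow_map]
  refine Nat.geomSum_lt le_rfl fun i hi => ?_
  obtain ⟨j, -, rfl⟩ := mem_map.1 hi
  exact j.isLt

theorem mask_bitSet {n x : ℕ} (hx : x < 2 ^ n) : mask (bitSet n x) = x := by
  refine Nat.eq_of_testBit_eq fun i => ?_
  by_cases hi : i < n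
  · have := congrArg (fun A => (⟨i, hi⟩ : Fin n) ∈ A) (bitSet_mask (bitSet n x))
    simp only [mem_bitSet, eq_iff_iff] at this
    exact Bool.eq_iff_iff.2 this
  · have h2 : 2 ^ n ≤ 2 ^ i := Nat.pow_le_pow_right (by norm_num) (by omega)
    rw [Nat.testBit_lt_two_pow ((mask_lt _).trans_le h2), Nat.testBit_lt_two_pow (hx.trans_le h2)]

theorem sum_range_bitSet {n : ℕ} {M : Type*} [AddCommMonoid M] (g : Finset (Fin n) → M) :
    ∑ z ∈ range (2 ^ n), g (bitSet n z) = ∑ S : Finset (Fin n), g S :=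
  sum_nbij' (fun z => bitSet n z) mask (by simp) (by simp [mask_lt])
    (fun z hz => mask_bitSet (mem_range.1 hz)) (by simp) (by simp)

theorem memberTest_eq {n : ℕ} (F : Finset (Finset (Fin n))) {z : ℕ} (hz : z < 2 ^ n) :
    (memberTest F z).toNat = if bitSet n z ∈ F then 1 else 0 := by
  have : (∃ A ∈ F, mask A = z) ↔ bitSet n z ∈ F :=
    ⟨by rintro ⟨A, hA, rfl⟩; simpa using hA, fun h => ⟨_, h, mask_bitSet hz⟩⟩
  unfold memberTest
  by_cases h : bitSet n z ∈ F <;> simp [this, h]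

@[simp] theorem bitSet_zero (n : ℕ) : bitSet n 0 = ∅ := by
  ext i
  simp

theorem unionCount_zero_right (n a : ℕ) : unionCount n a 0 = (bitSet n a).card := by
  simp [unionCount_eq]

/-- With |b| as the limit, the test on union sizes becomes a subset test, so the same enumeration
also lists the subsets of a set. -/
theorem unionCount_le_card_iff {n a b : ℕ} :
    unionCount n a b ≤ (bitSet n b).card ↔ bitSet n a ⊆ bitSet n b := by
  rw [unionCount_eq]
  constructor
  · intro h
    rw [← union_eq_right]
    exact (eq_of_subset_of_card_le subset_union_right h).symm
  · intro h
    rw [union_eq_right.2 h]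

theorem sum_memberTest_subset {n : ℕ} (F : Finset (Finset (Fin n))) (S : ℕ) :
    (∑ z ∈ range (2 ^ n), if unionCount n z S ≤ (bitSet n S).card then
      (memberTest F z).toNat else 0) = below F (bitSet n S) := by
  have h : ∀ z ∈ range (2 ^ n), (if unionCount n z S ≤ (bitSet n S).card then
      (memberTest F z).toNat else 0) =
      if bitSet n z ∈ F ∧ bitSet n z ⊆ bitSet n S then 1 else 0 := by
    intro z hz
    rw [memberTest_eq F (mem_range.1 hz)]
    simp only [unionCount_le_card_iff]
    split_ifs <;> simp_all
  rw [sum_congr rfl h,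
    sum_range_bitSet (g := fun A => if A ∈ F ∧ A ⊆ bitSet n S then 1 else 0),
    ← card_filter, below]
  congr 1
  ext A
  simp

theorem sum_memberTest_card {n m : ℕ} (F : Finset (Finset (Fin n))) (hF : ∀ A ∈ F, A.card = m) :
    (∑ z ∈ range (2 ^ n), if unionCount n z 0 ≤ m then (memberTest F z).toNat else 0) =
      F.card := by
  have h : ∀ z ∈ range (2 ^ n), (if unionCount n z 0 ≤ m then (memberTest F z).toNat else 0) =
      if bitSet n z ∈ F then 1 else 0 := by
    intro z hz
    rw [memberTest_eq F (mem_range.1 hz), unionCount_zero_right]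
    by_cases hz : bitSet n z ∈ F
    · simp [hz, hF _ hz]
    · simp [hz]
  rw [sum_congr rfl h, sum_range_bitSet (g := fun A => if A ∈ F then 1 else 0)]
  simp

theorem below_le {n : ℕ} (F : Finset (Finset (Fin n))) (S : Finset (Fin n)) :
    below F S ≤ 2 ^ n := by
  refine (card_le_univ _).trans ?_
  simp

theorem card_packings_one {n : ℕ} (F : Finset (Finset (Fin n))) : (packings F 1).card = F.card := by
  rw [packings, filter_true_of_mem, card_powersetCard, Nat.choose_one_right]
  intro P hP A hA A' hA' hne
  obtain ⟨A₀, rfl⟩ := card_eq_one.1 (mem_powersetCard.1 hP).2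
  rw [mem_singleton] at hA hA'
  exact absurd (hA.trans hA'.symm) hne

theorem card_packings_zero {n : ℕ} (F : Finset (Finset (Fin n))) : (packings F 0).card = 1 := by
  simp [packings, filter_true_of_mem]

theorem packings_eq_empty_of_lt {n k m : ℕ} {F : Finset (Finset (Fin n))}
    (hF : ∀ A ∈ F, A.card = m) (h : n < m * k) : packings F k = ∅ := by
  refine filter_eq_empty_iff.2 fun P hP hd => ?_
  rw [mem_powersetCard] at hP
  have h1 : (P.biUnion fun A => A).card = m * k := by
    rw [card_biUnion fun A hA A' hA' hne => hd A hA A' hA' hne]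
    rw [sum_congr rfl fun A hA => hF A (hP.1 hA), sum_const, hP.2, smul_eq_mul, mul_comm]
  have h2 := card_le_univ (P.biUnion fun A => A)
  rw [Fintype.card_fin] at h2
  omega

theorem packings_eq_empty_of_card_zero {n k : ℕ} {F : Finset (Finset (Fin n))}
    (hF : ∀ A ∈ F, A.card = 0) (h : 2 ≤ k) : packings F k = ∅ := by
  refine filter_eq_empty_iff.2 fun P hP _ => ?_
  rw [mem_powersetCard] at hP
  have h1 : P ⊆ {∅} := fun A hA => by simpa using hF A (hP.1 hA)
  have := card_le_card h1
  simp at this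
  omega

end Masks

/-! ### The counting programs -/

section Programs

open Finset

/-- Register `24` gets the number of sets accepted by the oracle among the sets whose union with
the set in register `y` has at most as many elements as register `c` says. -/
def countProg (y c : Fin 40) : Prog 40 :=
  .const 24 0 ;; enumProg 22 y c 23 (.query 31 22 ;; .arith .add 24 24 31)

/-- Used in two ways: with the limit |S| it counts the members inside S, and with the empty mask and
the limit m it counts the whole family. -/
theorem runs_countProg {O : ℕ → Bool} {B : ℕ} {y c : Fin 40}
    (hy : y.val < 30 ∧ y ≠ 22 ∧ y ≠ 23 ∧ y ≠ 24) (hc : c.val < 30 ∧ c ≠ 22 ∧ c ≠ 23 ∧ c ≠ 24)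
    {n : ℕ} (hB : 2 ^ n + n + 3 < 2 ^ B) {σ : Fin 40 → ℕ} (h0 : σ 0 = n) (h3 : σ 3 = 2 ^ n)
    (h4 : σ 4 = 1) (h5 : σ 5 = 2) (hzero : unionCount n 0 (σ y) ≤ σ c) :
    Runs O B (countProg y c) σ
      ((∑ z ∈ range (2 ^ n), if unionCount n z (σ y) ≤ σ c then 2 + roundCost n * (n + 1) else 0)
        + 4)
      fun τ => τ 24 = (∑ z ∈ range (2 ^ n),
        if unionCount n z (σ y) ≤ σ c then (O z).toNat else 0) ∧
        ∀ i : Fin 40, i.val < 30 → i ≠ 22 → i ≠ 23 → i ≠ 24 → τ i = σ i := by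
  have hB1 : 1 ≤ B := by
    rcases B with _ | B
    · simp at hB
    · omega
  refine .const_seq (by positivity) ?_
  refine (runs_enumProg (n := n) (Y := σ y) (C := σ c) (cost := fun _ => 2) (by decide)
    (by decide) hy.1 hc.1 (by decide) hB (fun z τ => τ 24 = (∑ a ∈ range z,
        if unionCount n a (σ y) ≤ σ c then (O a).toNat else 0) ∧
        ∀ i : Fin 40, i.val < 30 → i ≠ 22 → i ≠ 23 → i ≠ 24 → τ i = σ i)
    ?_ ?_ hzero ?_ ?_ ?_).mono (by omega) fun τ h => h
  · rintro z τ υ ⟨h24, hA⟩ h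
    exact ⟨(h 24 (by decide) (by decide) (by decide)).trans h24,
      fun i hi h1 h2 h3 => (h i hi h1 h2).trans (hA i hi h1 h2 h3)⟩
  · rintro z τ ⟨-, hA⟩
    exact ⟨(hA 0 (by decide) (by decide) (by decide) (by decide)).trans h0,
      (hA 3 (by decide) (by decide) (by decide) (by decide)).trans h3,
      (hA 4 (by decide) (by decide) (by decide) (by decide)).trans h4,
      (hA 5 (by decide) (by decide) (by decide) (by decide)).trans h5,
      hA y hy.1 hy.2.1 hy.2.2.1 hy.2.2.2, hA c hc.1 hc.2.1 hc.2.2.1 hc.2.2.2⟩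
  · rintro z τ - hz ⟨h24, hA⟩
    exact ⟨by rw [sum_range_succ, if_neg hz, add_zero, h24], hA⟩
  · rintro z τ hzn hz ⟨h24, hA⟩ h22
    have hle : τ 24 ≤ z := by
      rw [h24]
      refine (sum_le_card_nsmul _ _ 1 fun a _ => ?_).trans (by simp)
      split_ifs
      · exact Bool.toNat_le _
      · omega
    refine .query_seq hB1 (.add (fun _ => ?_) ⟨⟨?_, ?_⟩, ?_⟩)
    · have := Bool.toNat_le (O (τ 22))
      simp
      omega
    · simp [h24, h22, sum_range_succ, hz]
    · intro i hi h1 h2 h3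
      have : i ≠ 31 := by rintro rfl; simp at hi
      simp [h3, this, hA i hi h1 h2 h3]
    · simpa using h22
  · refine ⟨by simp, fun i hi h1 h2 h3 => by simp [h3]⟩

/-- The steps of `innerProg`, up to the factor `2 ^ |S|`. -/
def innerCost (n : ℕ) : ℕ := roundCost n * (n + 1) + 46 * n + 60

/-- With masks of sets `X` and `S` in registers `12` and `16`, add the terms for `S` in the
expansions of the two numbers of tuples whose union contains `X` to registers `18` and `20` if
`S` has an even number of elements, and to registers `19` and `21` otherwise. -/
def innerProg : Prog 40 :=
  unionCountProg 16 11 ;; .copy 25 30 ;; countProg 16 25 ;;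
  unionCountProg 16 12 ;; .arith .sub 26 0 30 ;;
  powProg 24 6 ;; .copy 27 30 ;; chooseProg 26 9 ;; .arith .mul 27 27 30 ;;
  powProg 24 7 ;; .copy 28 30 ;; chooseProg 26 10 ;; .arith .mul 28 28 30 ;;
  .arith .div 29 25 5 ;; .arith .mul 29 29 5 ;; .arith .sub 29 25 29 ;;
  .ite 29 (.arith .add 19 19 27 ;; .arith .add 21 21 28)
    (.arith .add 18 18 27 ;; .arith .add 20 20 28)

/-- The term for `S` in the expansion of the number of `j`-tuples whose union is a `q`-set
containing `X`, up to sign. -/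
def term {n : ℕ} (F : Finset (Finset (Fin n))) (j q X S : ℕ) : ℕ :=
  below F (bitSet n S) ^ j * (n - unionCount n S X).choose (n - q)

theorem pow_below_le {n : ℕ} (F : Finset (Finset (Fin n))) (S : Finset (Fin n)) {j : ℕ}
    (hj : j ≤ n) : below F S ^ j ≤ 2 ^ (n * n) :=
  calc below F S ^ j ≤ (2 ^ n) ^ j := Nat.pow_le_pow_left (below_le F S) j
    _ ≤ (2 ^ n) ^ n := Nat.pow_le_pow_right (by positivity) hj
    _ = 2 ^ (n * n) := by rw [pow_mul]

theorem term_le {n : ℕ} (F : Finset (Finset (Fin n))) {j : ℕ} (hj : j ≤ n) (q X S : ℕ) :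
    term F j q X S ≤ 2 ^ (n * n + n) := by
  rw [pow_add]
  exact Nat.mul_le_mul (pow_below_le F _ hj) ((Nat.choose_le_two_pow _ _).trans
    (Nat.pow_le_pow_right (by norm_num) (Nat.sub_le _ _)))

/-- The contents of the registers which remain unchanged during the main loop. -/
structure Setup (n j j' q q' Q : ℕ) (σ : Fin 40 → ℕ) : Prop where
  h0 : σ 0 = n
  h3 : σ 3 = 2 ^ n
  h4 : σ 4 = 1
  h5 : σ 5 = 2
  h6 : σ 6 = j
  h7 : σ 7 = j'
  h8 : σ 8 = Q
  h9 : σ 9 = n - q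
  h10 : σ 10 = n - q'
  h11 : σ 11 = 0
  hj : j ≤ n
  hj' : j' ≤ n

theorem Setup.of_agree {n j j' q q' Q b : ℕ} {σ τ : Fin 40 → ℕ} (h : Setup n j j' q q' Q σ)
    (hA : Agree b σ τ) (hb : 12 ≤ b) : Setup n j j' q q' Q τ where
  h0 := (hA 0 (by simp; omega)).trans h.h0
  h3 := (hA 3 (by simp; omega)).trans h.h3
  h4 := (hA 4 (by simp; omega)).trans h.h4
  h5 := (hA 5 (by simp; omega)).trans h.h5
  h6 := (hA 6 (by simp; omega)).trans h.h6
  h7 := (hA 7 (by simp; omega)).trans h.h7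
  h8 := (hA 8 (by simp; omega)).trans h.h8
  h9 := (hA 9 (by simp; omega)).trans h.h9
  h10 := (hA 10 (by simp; omega)).trans h.h10
  h11 := (hA 11 (by simp; omega)).trans h.h11
  hj := h.hj
  hj' := h.hj'

/-- The terms for both tuple lengths are computed from a single count of the members inside S, whose
2^|S| rounds dominate the cost. Registers hold natural numbers, so terms of opposite sign are
accumulated separately. -/
theorem runs_innerProg {n j j' q q' Q B : ℕ} (F : Finset (Finset (Fin n)))
    (hB : 2 ^ (n * n + n) + 2 ^ n * (n + 1) + 3 < 2 ^ B) {σ : Fin 40 → ℕ}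
    (hσ : Setup n j j' q q' Q σ)
    (h18 : σ 18 + 2 ^ (n * n + n) < 2 ^ B) (h19 : σ 19 + 2 ^ (n * n + n) < 2 ^ B)
    (h20 : σ 20 + 2 ^ (n * n + n) < 2 ^ B) (h21 : σ 21 + 2 ^ (n * n + n) < 2 ^ B) :
    Runs (memberTest F) B innerProg σ (innerCost n * 2 ^ (bitSet n (σ 16)).card) fun τ =>
      Agree 18 σ τ ∧
      τ 18 = σ 18 + (if Even (bitSet n (σ 16)).card then term F j q (σ 12) (σ 16) else 0) ∧
      τ 19 = σ 19 + (if Even (bitSet n (σ 16)).card then 0 else term F j q (σ 12) (σ 16)) ∧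
      τ 20 = σ 20 + (if Even (bitSet n (σ 16)).card then term F j' q' (σ 12) (σ 16) else 0) ∧
      τ 21 = σ 21 + (if Even (bitSet n (σ 16)).card then 0 else term F j' q' (σ 12) (σ 16)) := by
  have hpp : 0 < 2 ^ n * (n + 1) := by positivity
  have hB1 : 1 ≤ B := by
    rcases B with _ | B
    · simp at hB
    · omega
  have hn1 : 2 ^ n + n ≤ 2 ^ n * (n + 1) := by nlinarith [Nat.one_le_two_pow (n := n)]
  have hp2 : 0 < 2 ^ (n * n + n) := by positivity
  have hp3 : 0 < 2 ^ n := by positivity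
  have hB2 : 2 ^ n * (n + 1) < 2 ^ B := by omega
  set S := σ 16 with hS
  set X := σ 12 with hX
  set s := (bitSet n S).card with hs
  have hsn : s ≤ n := by simpa using card_le_univ (bitSet n S)
  have cost_le : (14 * n + 5) + (1 + (((∑ z ∈ range (2 ^ n),
      if unionCount n z S ≤ s then 2 + roundCost n * (n + 1) else 0) + 4) +
      ((14 * n + 5) + (1 + ((3 * n + 3) + (1 + ((6 * n + 4) + (1 + ((3 * n + 3) +
      (1 + ((6 * n + 4) + (2 + 1 + 1 + 1 + 1 + 1)))))))))))) ≤ innerCost n * 2 ^ s := by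
    have e : (∑ z ∈ range (2 ^ n), if unionCount n z S ≤ s then 2 + roundCost n * (n + 1) else 0) =
        2 ^ s * (2 + roundCost n * (n + 1)) := by
      simp only [hs, unionCount_le_card_iff]
      rw [sum_range_bitSet (g := fun A => if A ⊆ bitSet n S then 2 + roundCost n * (n + 1) else 0),
        ← sum_filter, sum_const, smul_eq_mul, ← card_powerset]
      congr 2
      ext A
      simp
    rw [e, innerCost]
    have : 1 ≤ 2 ^ s := Nat.one_le_two_pow
    nlinarith [Nat.zero_le n]
  refine Runs.mono ?_ cost_le fun _ h => h
  refine (runs_unionCountProg (by decide) (by decide) (by omega) hσ.h0 hσ.h4 hσ.h5).seq ?_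
  rintro τ₁ ⟨e30, a₁⟩
  have e30 : τ₁ 30 = s := by rw [e30, hσ.h11, unionCount_zero_right]
  refine (Runs.copy (Q := fun τ => τ 25 = s ∧ Agree 18 σ τ ∧ ∀ i : Fin 40, i.val < 22 → τ i = σ i)
    ⟨by simpa using e30, (a₁.of_le (by decide)).update (by decide) _,
      (a₁.of_le (by decide)).update (by decide) _⟩).seq ?_
  rintro τ₂ ⟨e25, a₂', a₂⟩
  have g₂ : Setup n j j' q q' Q τ₂ := hσ.of_agree a₂' (by decide)
  have e16 : τ₂ 16 = S := a₂ 16 (by decide)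
  have hcount := runs_countProg (O := memberTest F) (y := 16) (c := 25) (by decide) (by decide)
    (n := n) (B := B) (by omega) g₂.h0 g₂.h3 g₂.h4 g₂.h5
    (by rw [e16, e25, hs, unionCount_le_card_iff]; simp)
  rw [e16, e25] at hcount
  refine hcount.seq ?_
  rintro τ₃ ⟨e24, a₃⟩
  rw [hs, sum_memberTest_subset] at e24
  have a₃ : Agree 22 σ τ₃ ∧ τ₃ 25 = s := by
    refine ⟨fun i hi => ?_, (a₃ 25 (by decide) (by decide) (by decide) (by decide)).trans e25⟩
    rw [a₃ i (by omega) (by rintro rfl; simp at hi) (by rintro rfl; simp at hi)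
      (by rintro rfl; simp at hi), a₂ i hi]
  have g₃ : Setup n j j' q q' Q τ₃ := hσ.of_agree a₃.1 (by decide)
  refine (runs_unionCountProg (by decide) (by decide) (by omega) g₃.h0 g₃.h4 g₃.h5).seq ?_
  rintro τ₄ ⟨e30, a₄⟩
  rw [a₃.1 16 (by decide), a₃.1 12 (by decide)] at e30
  change τ₄ 30 = unionCount n S X at e30
  refine (Runs.sub (Q := fun τ => Agree 22 σ τ ∧ τ 25 = s ∧ τ 24 = below F (bitSet n S) ∧
    τ 26 = n - unionCount n S X) ⟨?_, ?_, ?_, ?_⟩).seq ?_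
  · exact (a₃.1.trans (a₄.of_le (by decide))).update (by decide) _
  · simpa using (a₄ 25 (by decide)).trans a₃.2
  · simpa using (a₄ 24 (by decide)).trans e24
  · simp [e30, a₄ 0 (by decide), g₃.h0]
  rintro τ₅ ⟨a₅, e25, e24, e26⟩
  have g₅ : Setup n j j' q q' Q τ₅ := hσ.of_agree a₅ (by decide)
  have hpowlt : ∀ i ≤ n, below F (bitSet n S) ^ i < 2 ^ B := fun i hi =>
    lt_of_le_of_lt ((pow_below_le F _ hi).trans
      (Nat.pow_le_pow_right (by norm_num) (Nat.le_add_right _ n))) (by omega)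
  refine ((runs_powProg (by decide) (by decide) hB1 g₅.h6
    (fun i hi => by rw [e24]; exact hpowlt i (hi.trans hσ.hj)) g₅.h4).mono
    (N' := 3 * n + 3) (by have := hσ.hj; omega) fun _ h => h).seq ?_
  rintro τ₆ ⟨e30, a₆⟩
  rw [e24] at e30
  refine (Runs.copy (Q := fun τ => Agree 27 τ₅ τ ∧ τ 27 = below F (bitSet n S) ^ j)
    ⟨(a₆.of_le (by decide)).update (by decide) _, by simpa using e30⟩).seq ?_
  rintro τ₇ ⟨a₇, e27⟩
  have g₇ : Setup n j j' q q' Q τ₇ := g₅.of_agree a₇ (by decide)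
  refine (runs_chooseProg (n := n) (by decide) (by decide) ((a₇ 26 (by decide)).trans e26) g₇.h9
    (Nat.sub_le _ _) (Nat.sub_le _ _) (by omega) g₇.h4).seq ?_
  rintro τ₈ ⟨e30, a₈⟩
  have htm : τ₈ 27 * τ₈ 30 = term F j q X S := by
    rw [a₈ 27 (by decide), e27, e30, term]
  refine (Runs.mul (Q := fun τ => Agree 27 τ₅ τ ∧ τ 27 = term F j q X S) (fun _ => ?_)
    ⟨(a₇.trans (a₈.of_le (by decide))).update (by decide) _, by simpa using htm⟩).seq ?_
  · rw [htm]
    exact lt_of_le_of_lt (term_le F hσ.hj _ _ _) (by omega)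
  rintro τ₉ ⟨a₉, e27⟩
  have g₉ : Setup n j j' q q' Q τ₉ := g₅.of_agree a₉ (by decide)
  have e24' : τ₉ 24 = below F (bitSet n S) := (a₉ 24 (by decide)).trans e24
  refine ((runs_powProg (by decide) (by decide) hB1 g₉.h7
    (fun i hi => by rw [e24']; exact hpowlt i (hi.trans hσ.hj')) g₉.h4).mono
    (N' := 3 * n + 3) (by have := hσ.hj'; omega) fun _ h => h).seq ?_
  rintro τ₆ ⟨e30, a₆⟩
  rw [e24'] at e30
  refine (Runs.copy (Q := fun τ => Agree 28 τ₉ τ ∧ τ 28 = below F (bitSet n S) ^ j')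
    ⟨(a₆.of_le (by decide)).update (by decide) _, by simpa using e30⟩).seq ?_
  rintro τ₇ ⟨a₇, e28⟩
  have g₇ : Setup n j j' q q' Q τ₇ := g₉.of_agree a₇ (by decide)
  refine (runs_chooseProg (n := n) (by decide) (by decide)
    ((a₇ 26 (by decide)).trans ((a₉ 26 (by decide)).trans e26)) g₇.h10
    (Nat.sub_le _ _) (Nat.sub_le _ _) (by omega) g₇.h4).seq ?_
  rintro τ₈ ⟨e30, a₈⟩
  have htm' : τ₈ 28 * τ₈ 30 = term F j' q' X S := by
    rw [a₈ 28 (by decide), e28, e30, term]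
  have b₈ : Agree 28 τ₉ τ₈ := a₇.trans (a₈.of_le (by decide))
  have e25' : τ₈ 25 = s := by
    rw [b₈ 25 (by decide), a₉ 25 (by decide), e25]
  have e27' : τ₈ 27 = term F j q X S := (b₈ 27 (by decide)).trans e27
  have b₈' : Agree 22 σ τ₈ := (a₅.trans (a₉.of_le (by decide))).trans (b₈.of_le (by decide))
  have g₈ : Setup n j j' q q' Q τ₈ := hσ.of_agree b₈' (by decide)
  have ht := term_le F hσ.hj q X S
  have ht' := term_le F hσ.hj' q' X S
  refine .mul_seq (fun _ => by rw [htm']; omega) (.div_seq (.mul_seq (fun _ => ?_) (.sub_seq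
    (Runs.ite (N := 2) (fun hodd => ?_) fun heven => ?_))))
  · simp [e25', g₈.h5]
    omega
  · have hpar : ¬ Even s := by
      simp [e25', g₈.h5] at hodd
      rw [Nat.even_iff]
      omega
    simp only [hpar, if_false]
    refine .add_seq (fun _ => ?_) (.add (fun _ => ?_) ⟨?_, ?_, ?_, ?_, ?_⟩)
    · simp [e27', b₈' 19 (by decide)]
      omega
    · simp [htm', b₈' 21 (by decide)]
      omega
    · repeat' refine Agree.update ?_ (by decide) _
      exact b₈'.of_le (by decide)
    all_goals simp [htm', e27', b₈' 18 (by decide), b₈' 19 (by decide), b₈' 20 (by decide),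
      b₈' 21 (by decide)]
  · have hpar : Even s := by
      simp [e25', g₈.h5] at heven
      rw [Nat.even_iff]
      omega
    simp only [hpar, if_true]
    refine .add_seq (fun _ => ?_) (.add (fun _ => ?_) ⟨?_, ?_, ?_, ?_, ?_⟩)
    · simp [e27', b₈' 18 (by decide)]
      omega
    · simp [htm', b₈' 20 (by decide)]
      omega
    · repeat' refine Agree.update ?_ (by decide) _
      exact b₈'.of_le (by decide)
    all_goals simp [htm', e27', b₈' 18 (by decide), b₈' 19 (by decide), b₈' 20 (by decide),
      b₈' 21 (by decide)]

/-- The sum of the terms for the sets of even size among the first `z` masks. -/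
def evenSum {n : ℕ} (F : Finset (Finset (Fin n))) (j q Q X z : ℕ) : ℕ :=
  ∑ S ∈ range z, if unionCount n S X ≤ Q then
    (if Even (bitSet n S).card then term F j q X S else 0) else 0

/-- The sum of the terms for the sets of odd size among the first `z` masks. -/
def oddSum {n : ℕ} (F : Finset (Finset (Fin n))) (j q Q X z : ℕ) : ℕ :=
  ∑ S ∈ range z, if unionCount n S X ≤ Q then
    (if Even (bitSet n S).card then 0 else term F j q X S) else 0

/-! ### The covering numbers of one set X, from the sum over S. -/

theorem sum_range_le_mul {f : ℕ → ℕ} {b : ℕ} (h : ∀ a, f a ≤ b) (z : ℕ) :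
    ∑ a ∈ range z, f a ≤ z * b :=
  (sum_le_card_nsmul _ _ b fun a _ => h a).trans (by simp)

theorem evenSum_le {n : ℕ} (F : Finset (Finset (Fin n))) {j : ℕ} (hj : j ≤ n) (q Q X z : ℕ) :
    evenSum F j q Q X z ≤ z * 2 ^ (n * n + n) := by
  refine sum_range_le_mul (fun S => ?_) z
  have := term_le F hj q X S
  split_ifs <;> omega

theorem oddSum_le {n : ℕ} (F : Finset (Finset (Fin n))) {j : ℕ} (hj : j ≤ n) (q Q X z : ℕ) :
    oddSum F j q Q X z ≤ z * 2 ^ (n * n + n) := by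
  refine sum_range_le_mul (fun S => ?_) z
  have := term_le F hj q X S
  split_ifs <;> omega

theorem evenSum_sub_oddSum {n : ℕ} (F : Finset (Finset (Fin n))) {j q Q : ℕ} (hqQ : q ≤ Q)
    (hq : q ≤ n) (X : ℕ) :
    (evenSum F j q Q X (2 ^ n) : ℤ) - oddSum F j q Q X (2 ^ n) =
      (-1) ^ q * covering F j q (bitSet n X) := by
  have h := sum_choose_mul_below_pow F (j := j) hqQ (by simpa using hq) (bitSet n X)
  rw [← h, ← sum_range_bitSet, evenSum, oddSum]
  push_cast
  rw [← sum_sub_distrib]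
  refine sum_congr rfl fun S _ => ?_
  rw [unionCount_eq, union_comm]
  split_ifs with h1 h2
  · simp [h2.neg_one_pow, term, unionCount_eq, union_comm, mul_comm]
  · simp [(Nat.not_even_iff_odd.1 h2).neg_one_pow, term, unionCount_eq, union_comm, mul_comm]
  · simp

/-- One of the two truncated differences is zero and the other is the absolute value, so the program
needs no knowledge of the parity of q. -/
theorem sub_add_sub_eq {a b c q : ℕ} (h : (a : ℤ) - b = (-1) ^ q * c) : a - b + (b - a) = c := by
  rcases Nat.even_or_odd q with hq | hq
  · rw [hq.neg_one_pow] at h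
    omega
  · rw [hq.neg_one_pow] at h
    omega

/-- With the mask of a set `X` in register `12`, add the term for `X` in the expansion of the
number of pairs of tuples with disjoint unions to register `14` if `X` has an even number of
elements, and to register `15` otherwise. -/
def outerProg : Prog 40 :=
  .const 18 0 ;; .const 19 0 ;; .const 20 0 ;; .const 21 0 ;;
  enumProg 16 12 8 17 innerProg ;;
  .arith .sub 26 18 19 ;; .arith .sub 27 19 18 ;; .arith .add 26 26 27 ;;
  .arith .sub 27 20 21 ;; .arith .sub 28 21 20 ;; .arith .add 27 27 28 ;;
  .arith .mul 26 26 27 ;; .copy 25 26 ;;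
  unionCountProg 12 11 ;;
  .arith .div 27 30 5 ;; .arith .mul 27 27 5 ;; .arith .sub 27 30 27 ;;
  .ite 27 (.arith .add 15 15 25) (.arith .add 14 14 25)

/-- The number of pairs of sets `S` with `|S ∪ X| ≤ Q` and of subsets of `S`. -/
def weight (n Q X : ℕ) : ℕ :=
  ∑ S ∈ range (2 ^ n), if unionCount n S X ≤ Q then 2 ^ (bitSet n S).card else 0

/-- The steps of `outerProg`, up to the factor `weight n Q X`. -/
def outerCost (n : ℕ) : ℕ := innerCost n + roundCost n * (n + 1) + 14 * n + 40

/-- The term S = ∅ contributes 1, so the fixed overhead for X can be absorbed into the weight. -/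
theorem one_le_weight {n Q X : ℕ} (h : unionCount n 0 X ≤ Q) : 1 ≤ weight n Q X := by
  refine le_trans ?_ (single_le_sum (f := fun S => if unionCount n S X ≤ Q then
    2 ^ (bitSet n S).card else 0) (fun _ _ => Nat.zero_le _)
    (mem_range.2 (show 0 < 2 ^ n by positivity)))
  simp [h]

/-- A number of bits which suffices for all registers. -/
def wordSize (n k m : ℕ) : ℕ := 2 * n * n + 6 * n + k + m + 10

theorem runs_outerProg {n j j' q q' Q B : ℕ} (F : Finset (Finset (Fin n)))
    (hB : 2 * n * n + 6 * n + 10 ≤ B) (hq : q ≤ Q) (hq' : q' ≤ Q) (hqn : q ≤ n) (hqn' : q' ≤ n)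
    {σ : Fin 40 → ℕ} (hσ : Setup n j j' q q' Q σ)
    (h14 : σ 14 + 2 ^ (2 * n * n + 4 * n) < 2 ^ B) (h15 : σ 15 + 2 ^ (2 * n * n + 4 * n) < 2 ^ B)
    (hX : unionCount n 0 (σ 12) ≤ Q) :
    Runs (memberTest F) B outerProg σ (outerCost n * weight n Q (σ 12)) fun τ =>
      Agree 14 σ τ ∧
      τ 14 = σ 14 + (if Even (bitSet n (σ 12)).card then
        covering F j q (bitSet n (σ 12)) * covering F j' q' (bitSet n (σ 12)) else 0) ∧
      τ 15 = σ 15 + (if Even (bitSet n (σ 12)).card then 0 else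
        covering F j q (bitSet n (σ 12)) * covering F j' q' (bitSet n (σ 12))) := by
  -- The 10 spare bits leave a factor 1024 for the small additive constants in the overflow checks.
  have hpow : ∀ e, e ≤ 2 * n * n + 6 * n → 2 ^ e * 1024 ≤ 2 ^ B := fun e he => by
    rw [show (1024 : ℕ) = 2 ^ 10 by norm_num, ← pow_add]
    exact Nat.pow_le_pow_right (by norm_num) (by omega)
  have hnn : n * n ≤ 2 * n * n := by nlinarith
  have p1 := hpow (2 * n) (by omega)
  have p2 := hpow (n * n + n) (by omega)
  have p3 := hpow (n * n + 2 * n) (by omega)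
  have p4 := hpow (2 * n * n + 4 * n) (by omega)
  have hp1 : 0 < 2 ^ (2 * n) := by positivity
  have hp2 : 0 < 2 ^ (n * n + n) := by positivity
  have hp3 : 0 < 2 ^ (n * n + 2 * n) := by positivity
  have hp4 : 0 < 2 ^ (2 * n * n + 4 * n) := by positivity
  have hn2 : n < 2 ^ n := Nat.lt_two_pow_self
  have e1 : 2 ^ (2 * n) = 2 ^ n * 2 ^ n := by rw [two_mul, pow_add]
  have e3 : 2 ^ (n * n + 2 * n) = 2 ^ n * 2 ^ (n * n + n) := by rw [← pow_add]; congr 1; ring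
  have e4 : 2 ^ (2 * n * n + 4 * n) = 2 ^ (n * n + 2 * n) * 2 ^ (n * n + 2 * n) := by
    rw [← pow_add]; congr 1; ring
  have hn1 : 2 ^ n * (n + 1) ≤ 2 ^ (2 * n) := by rw [e1]; exact Nat.mul_le_mul_left _ hn2
  have hn3 : 2 ^ n + n ≤ 2 ^ n * (n + 1) := by nlinarith [Nat.one_le_two_pow (n := n)]
  set X := σ 12 with hXdef
  have cost_le : (((∑ z ∈ range (2 ^ n), if unionCount n z X ≤ Q then
      innerCost n * 2 ^ (bitSet n z).card + roundCost n * (n + 1) else 0) + 3) +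
      ((14 * n + 5) + (2 + 1 + 1 + 1) + 1 + 1 + 1 + 1 + 1 + 1 + 1 + 1)) + 1 + 1 + 1 + 1 ≤
      outerCost n * weight n Q X := by
    have h1 : (∑ z ∈ range (2 ^ n), if unionCount n z X ≤ Q then
        innerCost n * 2 ^ (bitSet n z).card + roundCost n * (n + 1) else 0) ≤
        (innerCost n + roundCost n * (n + 1)) * weight n Q X := by
      rw [weight, mul_sum]
      refine sum_le_sum fun z _ => ?_
      split_ifs
      · have : 1 ≤ 2 ^ (bitSet n z).card := Nat.one_le_two_pow
        nlinarith [Nat.zero_le (roundCost n * (n + 1))]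
      · omega
    have h2 := one_le_weight hX
    have h3 : (14 * n + 40) * 1 ≤ (14 * n + 40) * weight n Q X := Nat.mul_le_mul_left _ h2
    rw [outerCost, show innerCost n + roundCost n * (n + 1) + 14 * n + 40 =
      (innerCost n + roundCost n * (n + 1)) + (14 * n + 40) by ring, add_mul]
    omega
  refine Runs.mono ?_ cost_le fun _ h => h
  have zlt : 0 < 2 ^ B := by positivity
  refine .const_seq zlt (.const_seq zlt (.const_seq zlt (.const_seq zlt ?_)))
  refine (runs_enumProg (n := n) (Y := X) (C := Q)
    (cost := fun z => innerCost n * 2 ^ (bitSet n z).card) (by decide)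
    (by decide) (by decide) (by decide) (by decide) (by omega) (fun z τ => Agree 16 σ τ ∧
      τ 18 = evenSum F j q Q X z ∧ τ 19 = oddSum F j q Q X z ∧
      τ 20 = evenSum F j' q' Q X z ∧ τ 21 = oddSum F j' q' Q X z)
    ?_ ?_ hX ?_ ?_ ?_).seq ?_
  · rintro z τ υ ⟨hA, h18, h19, h20, h21⟩ h
    refine ⟨fun i hi => (h i (by omega) ?_ ?_).trans (hA i hi), ?_, ?_, ?_, ?_⟩
    · rintro rfl; simp at hi
    · rintro rfl; simp at hi
    · exact (h 18 (by decide) (by decide) (by decide)).trans h18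
    · exact (h 19 (by decide) (by decide) (by decide)).trans h19
    · exact (h 20 (by decide) (by decide) (by decide)).trans h20
    · exact (h 21 (by decide) (by decide) (by decide)).trans h21
  · rintro z τ ⟨hA, -⟩
    have g := hσ.of_agree hA (by decide)
    exact ⟨g.h0, g.h3, g.h4, g.h5, hA 12 (by decide), g.h8⟩
  · rintro z τ - hz ⟨hA, h18, h19, h20, h21⟩
    refine ⟨hA, ?_, ?_, ?_, ?_⟩ <;>
      simp only [evenSum, oddSum, sum_range_succ, if_neg hz, add_zero] <;> assumption
  · rintro z τ hzn hz ⟨hA, h18, h19, h20, h21⟩ h16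
    have g := hσ.of_agree hA (by decide)
    have e12 : τ 12 = X := hA 12 (by decide)
    have hle : z * 2 ^ (n * n + n) + 2 ^ (n * n + n) < 2 ^ B := by
      have : (z + 1) * 2 ^ (n * n + n) ≤ 2 ^ (n * n + 2 * n) := by
        rw [e3]
        exact Nat.mul_le_mul_right _ hzn
      rw [add_mul, one_mul] at this
      omega
    have hrun := runs_innerProg F (B := B) (σ := τ) (by omega) g
      (by have := evenSum_le F hσ.hj q Q X z; omega) (by have := oddSum_le F hσ.hj q Q X z; omega)
      (by have := evenSum_le F hσ.hj' q' Q X z; omega)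
      (by have := oddSum_le F hσ.hj' q' Q X z; omega)
    rw [h16, e12] at hrun
    refine hrun.mono le_rfl ?_
    rintro υ ⟨hA', k18, k19, k20, k21⟩
    refine ⟨⟨hA.trans (hA'.of_le (by decide)), ?_, ?_, ?_, ?_⟩, (hA' 16 (by decide)).trans h16⟩
    · rw [k18, h18]; simp only [evenSum, sum_range_succ, if_pos hz]
    · rw [k19, h19]; simp only [oddSum, sum_range_succ, if_pos hz]
    · rw [k20, h20]; simp only [evenSum, sum_range_succ, if_pos hz]
    · rw [k21, h21]; simp only [oddSum, sum_range_succ, if_pos hz]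
  · refine ⟨?_, by simp [evenSum], by simp [oddSum], by simp [evenSum], by simp [oddSum]⟩
    repeat' refine Agree.update ?_ (by decide) _
    exact .refl _ _
  rintro τ ⟨hA, h18, h19, h20, h21⟩
  have g := hσ.of_agree hA (by decide)
  have b18 := evenSum_le F hσ.hj q Q X (2 ^ n)
  have b19 := oddSum_le F hσ.hj q Q X (2 ^ n)
  have b20 := evenSum_le F hσ.hj' q' Q X (2 ^ n)
  have b21 := oddSum_le F hσ.hj' q' Q X (2 ^ n)
  rw [← e3] at b18 b19 b20 b21
  have c1 := sub_add_sub_eq (evenSum_sub_oddSum F (j := j) hq hqn X)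
  have c2 := sub_add_sub_eq (evenSum_sub_oddSum F (j := j') hq' hqn' X)
  rw [← h18, ← h19] at c1
  rw [← h20, ← h21] at c2
  have d1 : covering F j q (bitSet n X) ≤ 2 ^ (n * n + 2 * n) := by omega
  have d2 : covering F j' q' (bitSet n X) ≤ 2 ^ (n * n + 2 * n) := by omega
  have d3 : covering F j q (bitSet n X) * covering F j' q' (bitSet n X) ≤
      2 ^ (2 * n * n + 4 * n) := by
    rw [e4]
    exact Nat.mul_le_mul d1 d2
  refine .sub_seq (.sub_seq (.add_seq (fun _ => ?_) (.sub_seq (.sub_seq (.add_seq (fun _ => ?_)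
    (.mul_seq (fun _ => ?_) (.copy_seq ?_)))))))
  · simp [c1]; omega
  · simp [c2]; omega
  · simp [c1, c2]; omega
  set ρ := Function.update (Function.update (Function.update (Function.update (Function.update
    (Function.update (Function.update (Function.update τ 26 _) 27 _) 26 _) 27 _) 28 _) 27 _) 26 _)
    25 _ with hρ
  have e25 : ρ 25 = covering F j q (bitSet n X) * covering F j' q' (bitSet n X) := by
    simp [hρ, c1, c2]
  have hA' : Agree 16 σ ρ := by
    rw [hρ]
    repeat' refine Agree.update ?_ (by decide) _
    exact hA
  clear_value ρ
  have g' := hσ.of_agree hA' (by decide)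
  refine Runs.mono (N := (14 * n + 5) + (2 + 1 + 1 + 1)) ?_ (by omega) fun _ h => h
  refine (runs_unionCountProg (by decide) (by decide) (by omega) g'.h0 g'.h4 g'.h5).seq ?_
  rintro υ ⟨h30, hA''⟩
  rw [g'.h11, unionCount_zero_right, hA' 12 (by decide)] at h30
  change υ 30 = (bitSet n X).card at h30
  have hb : Agree 16 σ υ := hA'.trans (hA''.of_le (by decide))
  have g'' := hσ.of_agree hb (by decide)
  have e25' := (hA'' 25 (by decide)).trans e25
  have hXn : (bitSet n X).card ≤ n := by simpa using card_le_univ (bitSet n X)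
  refine .div_seq (.mul_seq (fun _ => ?_) (.sub_seq (Runs.ite (N := 1) (fun hodd => ?_)
    fun heven => ?_)))
  · simp [h30, g''.h5]; omega
  · have hpar : ¬ Even (bitSet n X).card := by
      simp [h30, g''.h5] at hodd
      rw [Nat.even_iff]
      omega
    simp only [hpar, if_false]
    refine .add (fun _ => ?_) ⟨?_, ?_, ?_⟩
    · simp [e25', hb 15 (by decide)]; omega
    · repeat' refine Agree.update ?_ (by decide) _
      exact hb.of_le (by decide)
    · simp [hb 14 (by decide)]
    · simp [e25', hb 15 (by decide)]
  · have hpar : Even (bitSet n X).card := by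
      simp [h30, g''.h5] at heven
      rw [Nat.even_iff]
      omega
    simp only [hpar, if_true]
    refine .add (fun _ => ?_) ⟨?_, ?_, ?_⟩
    · simp [e25', hb 14 (by decide)]; omega
    · repeat' refine Agree.update ?_ (by decide) _
      exact hb.of_le (by decide)
    · simp [e25', hb 14 (by decide)]
    · simp [hb 15 (by decide)]

/-! ### The sum over X and the main loop. -/

theorem covering_le {n : ℕ} (F : Finset (Finset (Fin n))) {j : ℕ} (hj : j ≤ n) (q : ℕ)
    (X : Finset (Fin n)) : covering F j q X ≤ 2 ^ (n * n) := by
  have h : (tuples F j).card ≤ 2 ^ (n * n) := by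
    have hF : F.card ≤ 2 ^ n := by simpa using card_le_univ F
    calc (tuples F j).card = F.card ^ j := by simp [tuples]
      _ ≤ (2 ^ n) ^ j := Nat.pow_le_pow_left hF j
      _ ≤ (2 ^ n) ^ n := Nat.pow_le_pow_right (by positivity) hj
      _ = 2 ^ (n * n) := by rw [pow_mul]
  exact (card_filter_le _ _).trans h

/-- Register `0` gets the number of `k`-packings, for the parameters in the registers from `1`
to `11`. -/
def mainLoop : Prog 40 :=
  .const 14 0 ;; .const 15 0 ;; enumProg 12 11 8 13 outerProg ;;
  .arith .sub 26 14 15 ;; factorialProg 1 ;; .arith .div 0 26 30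

/-- The sum of the products of two covering numbers for the sets of even size among the first
`z` masks. -/
def evenTotal {n : ℕ} (F : Finset (Finset (Fin n))) (j j' q q' Q z : ℕ) : ℕ :=
  ∑ X ∈ range z, if unionCount n X 0 ≤ Q then (if Even (bitSet n X).card then
    covering F j q (bitSet n X) * covering F j' q' (bitSet n X) else 0) else 0

/-- The sum of the products of two covering numbers for the sets of odd size among the first
`z` masks. -/
def oddTotal {n : ℕ} (F : Finset (Finset (Fin n))) (j j' q q' Q z : ℕ) : ℕ :=
  ∑ X ∈ range z, if unionCount n X 0 ≤ Q then (if Even (bitSet n X).card then 0 else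
    covering F j q (bitSet n X) * covering F j' q' (bitSet n X)) else 0

theorem evenTotal_sub_oddTotal {n m j j' Q : ℕ} {F : Finset (Finset (Fin n))}
    (hF : ∀ A ∈ F, A.card = m) (hm : 1 ≤ m) (hQ : m * j ≤ Q) :
    evenTotal F j j' (m * j) (m * j') Q (2 ^ n) - oddTotal F j j' (m * j) (m * j') Q (2 ^ n) =
      (j + j').factorial * (packings F (j + j')).card := by
  have h := sum_alternating_covering hF hm (j := j) (j' := j') hQ
  have e : (evenTotal F j j' (m * j) (m * j') Q (2 ^ n) : ℤ) -
      oddTotal F j j' (m * j) (m * j') Q (2 ^ n) =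
      ((j + j').factorial * (packings F (j + j')).card : ℕ) := by
    unfold packings
    convert h using 1
    rw [← sum_range_bitSet, evenTotal, oddTotal]
    push_cast
    rw [← sum_sub_distrib]
    refine sum_congr rfl fun X _ => ?_
    rw [unionCount_zero_right]
    split_ifs with h1 h2
    · simp [h2.neg_one_pow]
    · simp [(Nat.not_even_iff_odd.1 h2).neg_one_pow]
    · simp
  -- The integer difference is a natural number, so the truncated difference agrees with it.
  omega

/-- The steps of the whole program, up to the factor `max 1 (5 ^ Q * n.choose Q)`. -/
def totalCost (n : ℕ) : ℕ := (outerCost n + roundCost n * (n + 1) + 10 * n + 60) * (n + 1)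

theorem sum_weight_le {n Q : ℕ} (hQ : 3 * Q ≤ 2 * n) :
    (∑ X ∈ range (2 ^ n), weight n Q X) ≤ (n + 1) * (5 ^ Q * n.choose Q) := by
  have h : ∀ X ∈ range (2 ^ n), weight n Q X =
      ∑ S : Finset (Fin n), if (bitSet n X ∪ S).card ≤ Q then 2 ^ S.card else 0 := by
    intro X _
    rw [weight, ← sum_range_bitSet]
    refine sum_congr rfl fun S _ => ?_
    rw [unionCount_eq, union_comm]
  rw [sum_congr rfl h, sum_range_bitSet (g := fun X => ∑ S : Finset (Fin n),
    if (X ∪ S).card ≤ Q then 2 ^ S.card else 0), sum_two_pow_card_of_union_le, Fintype.card_fin]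
  refine (sum_le_card_nsmul _ _ (5 ^ Q * n.choose Q) fun u hu => ?_).trans ?_
  · rw [mul_comm (5 ^ Q)]
    exact choose_mul_five_pow_mono hQ (by simpa [Nat.lt_succ_iff] using hu)
  · rw [card_range, smul_eq_mul]
    exact Nat.mul_le_mul_right _ (by omega)

/-- Since j' ≤ j, the limit Q = mj is at least both union sizes. The final division by k! is exact.
-/
theorem runs_mainLoop {n m k j j' B : ℕ} {F : Finset (Finset (Fin n))}
    (hF : ∀ A ∈ F, A.card = m) (hm : 1 ≤ m) (hB : 2 * n * n + 6 * n + 10 ≤ B) (hk : j + j' = k)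
    (hkn : k ≤ n) (hjj : j' ≤ j) (hQ : 3 * (m * j) ≤ 2 * n) {σ : Fin 40 → ℕ}
    (hσ : Setup n j j' (m * j) (m * j') (m * j) σ) (h1 : σ 1 = k) :
    Runs (memberTest F) B mainLoop σ
      ((outerCost n + roundCost n * (n + 1) + 3 * n + 10) *
        ((n + 1) * (5 ^ (m * j) * n.choose (m * j))))
      fun τ => τ 0 = (packings F k).card := by
  have hpow : ∀ e, e ≤ 2 * n * n + 6 * n → 2 ^ e * 1024 ≤ 2 ^ B := fun e he => by
    rw [show (1024 : ℕ) = 2 ^ 10 by norm_num, ← pow_add]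
    exact Nat.pow_le_pow_right (by norm_num) (by omega)
  have hnn : n * n ≤ 2 * n * n := by nlinarith
  have p1 := hpow n (by omega)
  have p2 := hpow (n * n) (by omega)
  have p3 := hpow (2 * n * n + 5 * n) (by omega)
  have hp3 : 0 < 2 ^ (2 * n * n + 5 * n) := by positivity
  have hp2 : 0 < 2 ^ (n * n) := by positivity
  have hn2 : n < 2 ^ n := Nat.lt_two_pow_self
  have e3 : 2 ^ (2 * n * n + 5 * n) = 2 ^ n * 2 ^ (2 * n * n + 4 * n) := by
    rw [← pow_add]; congr 1; ring
  have hfac : k.factorial < 2 ^ B := by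
    calc k.factorial ≤ k ^ k := Nat.factorial_le_pow k
      _ ≤ (2 ^ n) ^ k := Nat.pow_le_pow_left (by omega) k
      _ ≤ (2 ^ n) ^ n := Nat.pow_le_pow_right (by positivity) hkn
      _ = 2 ^ (n * n) := by rw [pow_mul]
      _ < 2 ^ B := by omega
  have hcov : ∀ X : ℕ, covering F j (m * j) (bitSet n X) * covering F j' (m * j') (bitSet n X) ≤
      2 ^ (2 * n * n + 4 * n) := fun X =>
    calc _ ≤ 2 ^ (n * n) * 2 ^ (n * n) :=
          Nat.mul_le_mul (covering_le F hσ.hj _ _) (covering_le F hσ.hj' _ _)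
      _ = 2 ^ (n * n + n * n) := by rw [pow_add]
      _ ≤ 2 ^ (2 * n * n + 4 * n) := Nat.pow_le_pow_right (by norm_num) (by nlinarith)
  have bE : ∀ z, evenTotal F j j' (m * j) (m * j') (m * j) z ≤ z * 2 ^ (2 * n * n + 4 * n) :=
    fun z => sum_range_le_mul (fun X => by have := hcov X; split_ifs <;> omega) z
  have bO : ∀ z, oddTotal F j j' (m * j) (m * j') (m * j) z ≤ z * 2 ^ (2 * n * n + 4 * n) :=
    fun z => sum_range_le_mul (fun X => by have := hcov X; split_ifs <;> omega) z
  have hq' : m * j' ≤ m * j := Nat.mul_le_mul_left m hjj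
  have cost_le : (((∑ z ∈ range (2 ^ n), if unionCount n z 0 ≤ m * j then
      outerCost n * weight n (m * j) z + roundCost n * (n + 1) else 0) + 3) +
      ((3 * k + 3) + 1 + 1)) + 1 + 1 ≤ (outerCost n + roundCost n * (n + 1) + 3 * n + 10) *
        ((n + 1) * (5 ^ (m * j) * n.choose (m * j))) := by
    have h2 : (∑ z ∈ range (2 ^ n), if unionCount n z 0 ≤ m * j then
        outerCost n * weight n (m * j) z + roundCost n * (n + 1) else 0) ≤
        (outerCost n + roundCost n * (n + 1)) * ∑ X ∈ range (2 ^ n), weight n (m * j) X := by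
      rw [mul_sum]
      refine sum_le_sum fun z _ => ?_
      split_ifs with h
      · have : 1 ≤ weight n (m * j) z := one_le_weight (by
          rwa [unionCount_eq, union_comm, ← unionCount_eq])
        nlinarith [Nat.zero_le (roundCost n * (n + 1))]
      · omega
    have h3 : 1 ≤ (n + 1) * (5 ^ (m * j) * n.choose (m * j)) :=
      Nat.succ_le_of_lt (Nat.mul_pos n.succ_pos (Nat.mul_pos (by positivity)
        (Nat.choose_pos (by omega))))
    have h4 := Nat.mul_le_mul_left (outerCost n + roundCost n * (n + 1)) (sum_weight_le hQ)
    have h5 := Nat.mul_le_mul_left (3 * n + 10) h3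
    rw [add_assoc _ (3 * n) 10, add_mul]
    omega
  refine Runs.mono ?_ cost_le fun _ h => h
  have zlt : 0 < 2 ^ B := by positivity
  refine .const_seq zlt (.const_seq zlt ?_)
  refine (runs_enumProg (n := n) (Y := 0) (C := m * j)
    (cost := fun z => outerCost n * weight n (m * j) z) (by decide)
    (by decide) (by decide) (by decide) (by decide) (by omega) (fun z τ => Agree 12 σ τ ∧
      τ 14 = evenTotal F j j' (m * j) (m * j') (m * j) z ∧
      τ 15 = oddTotal F j j' (m * j) (m * j') (m * j) z)
    ?_ ?_ (by simp [unionCount_zero_right]) ?_ ?_ ?_).seq ?_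
  · rintro z τ υ ⟨hA, h14, h15⟩ h
    refine ⟨fun i hi => (h i (by omega) ?_ ?_).trans (hA i hi), ?_, ?_⟩
    · rintro rfl; simp at hi
    · rintro rfl; simp at hi
    · exact (h 14 (by decide) (by decide) (by decide)).trans h14
    · exact (h 15 (by decide) (by decide) (by decide)).trans h15
  · rintro z τ ⟨hA, -⟩
    have g := hσ.of_agree hA le_rfl
    exact ⟨g.h0, g.h3, g.h4, g.h5, g.h11, g.h8⟩
  · rintro z τ - hz ⟨hA, h14, h15⟩
    refine ⟨hA, ?_, ?_⟩ <;>
      simp only [evenTotal, oddTotal, sum_range_succ, if_neg hz, add_zero] <;> assumption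
  · rintro z τ hzn hz ⟨hA, h14, h15⟩ h12
    have g := hσ.of_agree hA le_rfl
    have hle : z * 2 ^ (2 * n * n + 4 * n) + 2 ^ (2 * n * n + 4 * n) < 2 ^ B := by
      have : (z + 1) * 2 ^ (2 * n * n + 4 * n) ≤ 2 ^ (2 * n * n + 5 * n) := by
        rw [e3]
        exact Nat.mul_le_mul_right _ hzn
      rw [add_mul, one_mul] at this
      omega
    have hrun := runs_outerProg F (B := B) (σ := τ) hB le_rfl hq' (by omega) (by omega) g
      (by have := bE z; omega) (by have := bO z; omega)
      (by rw [h12, unionCount_eq, union_comm, ← unionCount_eq]; exact hz)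
    rw [h12] at hrun
    refine hrun.mono le_rfl ?_
    rintro υ ⟨hA', k14, k15⟩
    refine ⟨⟨hA.trans (hA'.of_le (by decide)), ?_, ?_⟩, (hA' 12 (by decide)).trans h12⟩
    · rw [k14, h14]; simp only [evenTotal, sum_range_succ, if_pos hz]
    · rw [k15, h15]; simp only [oddTotal, sum_range_succ, if_pos hz]
  · refine ⟨?_, by simp [evenTotal], by simp [oddTotal]⟩
    repeat' refine Agree.update ?_ (by decide) _
    exact .refl _ _
  rintro τ ⟨hA, h14, h15⟩
  have g := hσ.of_agree hA le_rfl
  refine .sub_seq (Runs.mono (N := (3 * k + 3) + 1) ?_ (by omega) fun _ h => h)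
  refine (runs_factorialProg (k := k) (by decide) (by omega) ?_ hfac ?_).seq ?_
  · simpa using (hA 1 (by decide)).trans h1
  · simpa using g.h4
  rintro υ ⟨h30, hA'⟩
  refine .div ?_
  have h26 := hA' 26 (by decide)
  simp only [Function.update_self] at h26 ⊢
  rw [h26, h30, h14, h15, evenTotal_sub_oddTotal hF hm le_rfl, hk]
  exact Nat.mul_div_cancel_left _ k.factorial_pos

/-- The setup of the main loop, and the main loop. -/
def mainProg : Prog 40 :=
  .arith .add 6 1 4 ;; .arith .div 6 6 5 ;; .arith .div 7 1 5 ;; .arith .mul 8 2 6 ;;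
  .arith .mul 9 2 7 ;; .arith .sub 10 0 9 ;; .arith .sub 9 0 8 ;;
  powProg 5 0 ;; .copy 3 30 ;; mainLoop

/-- The extreme case is k = 3, where ⌈k/2⌉ is exactly 2k/3; for k = 1 the bound on ⌈k/2⌉ fails. -/
theorem three_mul_le {n k m : ℕ} (hk : 2 ≤ k) (h : m * k ≤ n) : 3 * (m * ((k + 1) / 2)) ≤ 2 * n := by
  have h2 : 3 * ((k + 1) / 2) ≤ 2 * k := by omega
  calc 3 * (m * ((k + 1) / 2)) = m * (3 * ((k + 1) / 2)) := by ring
    _ ≤ m * (2 * k) := Nat.mul_le_mul_left _ h2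
    _ = 2 * (m * k) := by ring
    _ ≤ 2 * n := Nat.mul_le_mul_left _ h

theorem runs_mainProg {n m k B : ℕ} {F : Finset (Finset (Fin n))}
    (hF : ∀ A ∈ F, A.card = m) (hm : 1 ≤ m) (hB : 2 * n * n + 6 * n + 10 ≤ B) (hk : 2 ≤ k)
    (hmk : m * k ≤ n) {σ : Fin 40 → ℕ} (h0 : σ 0 = n) (h1 : σ 1 = k) (h2 : σ 2 = m)
    (h4 : σ 4 = 1) (h5 : σ 5 = 2) (h11 : σ 11 = 0) :
    Runs (memberTest F) B mainProg σ
      ((outerCost n + roundCost n * (n + 1) + 6 * n + 30) *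
        ((n + 1) * (5 ^ (m * ((k + 1) / 2)) * n.choose (m * ((k + 1) / 2)))))
      fun τ => τ 0 = (packings F k).card := by
  have hQ := three_mul_le hk hmk
  have hkn : k ≤ n := le_trans (Nat.le_mul_of_pos_left k hm) hmk
  have hn2 : n < 2 ^ n := Nat.lt_two_pow_self
  have hnB : 2 ^ n * 2 ≤ 2 ^ B := by
    rw [← pow_succ]
    exact Nat.pow_le_pow_right (by norm_num) (by omega)
  have hj' : m * (k / 2) ≤ m * ((k + 1) / 2) := Nat.mul_le_mul_left m (by omega)
  have cost_le : ((3 * n + 3) + (1 + (outerCost n + roundCost n * (n + 1) + 3 * n + 10) *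
      ((n + 1) * (5 ^ (m * ((k + 1) / 2)) * n.choose (m * ((k + 1) / 2)))))) + 1 + 1 + 1 + 1 + 1 +
      1 + 1 ≤ (outerCost n + roundCost n * (n + 1) + 6 * n + 30) *
        ((n + 1) * (5 ^ (m * ((k + 1) / 2)) * n.choose (m * ((k + 1) / 2)))) := by
    have h3 : 1 ≤ (n + 1) * (5 ^ (m * ((k + 1) / 2)) * n.choose (m * ((k + 1) / 2))) :=
      Nat.succ_le_of_lt (Nat.mul_pos n.succ_pos (Nat.mul_pos (by positivity)
        (Nat.choose_pos (by omega))))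
    have h6 := Nat.mul_le_mul_left (3 * n + 20) h3
    rw [show outerCost n + roundCost n * (n + 1) + 6 * n + 30 =
      (outerCost n + roundCost n * (n + 1) + 3 * n + 10) + (3 * n + 20) by ring, add_mul _ (3 * n + 20)]
    omega
  refine Runs.mono ?_ cost_le fun _ h => h
  refine .add_seq (fun _ => by omega) (.div_seq (.div_seq (.mul_seq (fun _ => ?_)
    (.mul_seq (fun _ => ?_) (.sub_seq (.sub_seq ?_))))))
  · simp [h1, h2, h4, h5]; omega
  · simp [h1, h2, h5]; omega
  set ρ := Function.update (Function.update (Function.update (Function.update (Function.update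
    (Function.update (Function.update σ 6 _) 6 _) 7 _) 8 _) 9 _) 10 _) 9 _ with hρ
  have r0 : ρ 0 = n := by simp [hρ, h0]
  have r1 : ρ 1 = k := by simp [hρ, h1]
  have r4 : ρ 4 = 1 := by simp [hρ, h4]
  have r5 : ρ 5 = 2 := by simp [hρ, h5]
  have r6 : ρ 6 = (k + 1) / 2 := by simp [hρ, h1, h4, h5]
  have r7 : ρ 7 = k / 2 := by simp [hρ, h1, h5]
  have r8 : ρ 8 = m * ((k + 1) / 2) := by simp [hρ, h1, h2, h4, h5]
  have r9 : ρ 9 = n - m * ((k + 1) / 2) := by simp [hρ, h0, h1, h2, h4, h5]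
  have r10 : ρ 10 = n - m * (k / 2) := by simp [hρ, h0, h1, h2, h5]
  have r11 : ρ 11 = 0 := by simp [hρ, h11]
  clear_value ρ
  have hpow : ∀ i ≤ n, ρ 5 ^ i < 2 ^ B := fun i hi => by
    rw [r5]
    exact Nat.pow_lt_pow_right (by norm_num) (by omega)
  refine (runs_powProg (by decide) (by decide) (by omega) r0 hpow r4).seq ?_
  rintro τ ⟨h30, hA⟩
  refine (Runs.copy (Q := (· = Function.update τ 3 (τ 30))) rfl).seq ?_
  rintro _ rfl
  refine runs_mainLoop hF hm hB (by omega) hkn (by omega) hQ (j' := k / 2) ?_ ?_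
  · constructor
    · simpa using (hA 0 (by decide)).trans r0
    · simp [h30, r5]
    · simpa using (hA 4 (by decide)).trans r4
    · simpa using (hA 5 (by decide)).trans r5
    · simpa using (hA 6 (by decide)).trans r6
    · simpa using (hA 7 (by decide)).trans r7
    · simpa using (hA 8 (by decide)).trans r8
    · simpa using (hA 9 (by decide)).trans r9
    · simpa using (hA 10 (by decide)).trans r10
    · simpa using (hA 11 (by decide)).trans r11
    · omega
    · omega
  · simpa using (hA 1 (by decide)).trans r1

/-- Register `0` gets the number of members of the family. -/
def countMembersProg : Prog 40 :=
  powProg 5 0 ;; .copy 3 30 ;; countProg 11 2 ;; .copy 0 24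

theorem runs_countMembersProg {n m B : ℕ} {F : Finset (Finset (Fin n))}
    (hF : ∀ A ∈ F, A.card = m) (hmn : m ≤ n) (hB : 2 * n + 10 ≤ B) {σ : Fin 40 → ℕ}
    (h0 : σ 0 = n) (h2 : σ 2 = m) (h4 : σ 4 = 1) (h5 : σ 5 = 2) (h11 : σ 11 = 0) :
    Runs (memberTest F) B countMembersProg σ
      ((roundCost n * (n + 1) + 3 * n + 20) * ((n + 1) * (5 ^ m * n.choose m)))
      fun τ => τ 0 = F.card := by
  have hn2 : n < 2 ^ n := Nat.lt_two_pow_self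
  have hnB : 2 ^ n * 4 ≤ 2 ^ B := by
    rw [show (4 : ℕ) = 2 ^ 2 by norm_num, ← pow_add]
    exact Nat.pow_le_pow_right (by norm_num) (by omega)
  have h2B : 2 ^ 10 ≤ 2 ^ B := Nat.pow_le_pow_right (by norm_num) (by omega)
  have cost_le : (3 * n + 3) + (1 + (((∑ z ∈ range (2 ^ n),
      if unionCount n z 0 ≤ m then 2 + roundCost n * (n + 1) else 0) + 4) + 1)) ≤
      (roundCost n * (n + 1) + 3 * n + 20) * ((n + 1) * (5 ^ m * n.choose m)) := by
    have h3 : 1 ≤ (n + 1) * (5 ^ m * n.choose m) :=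
      Nat.succ_le_of_lt (Nat.mul_pos n.succ_pos (Nat.mul_pos (by positivity)
        (Nat.choose_pos hmn)))
    have h6 : (∑ z ∈ range (2 ^ n),
        if unionCount n z 0 ≤ m then 2 + roundCost n * (n + 1) else 0) =
        (∑ u ∈ range (m + 1), n.choose u) * (2 + roundCost n * (n + 1)) := by
      simp only [unionCount_zero_right]
      rw [sum_range_bitSet (g := fun A : Finset (Fin n) =>
        if A.card ≤ m then 2 + roundCost n * (n + 1) else 0), ← sum_filter, sum_const, smul_eq_mul]
      congr 1
      rw [card_eq_sum_card_fiberwise (f := card) (t := range (m + 1))]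
      · refine sum_congr rfl fun u hu => ?_
        rw [filter_filter]
        have : (univ.filter fun A : Finset (Fin n) => A.card ≤ m ∧ A.card = u) =
            powersetCard u univ := by
          ext A
          simp only [mem_filter, mem_univ, true_and, mem_powersetCard, subset_univ]
          have := mem_range.1 hu
          omega
        rw [this, card_powersetCard, card_univ, Fintype.card_fin]
      · intro A hA
        simp only [coe_filter, mem_univ, true_and, Set.mem_ofPred_eq] at hA
        simp only [coe_range, Set.mem_Iio]
        omega
    have h7 : (∑ u ∈ range (m + 1), n.choose u) ≤ (n + 1) * (5 ^ m * n.choose m) := by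
      refine (sum_le_card_nsmul _ _ (5 ^ m * n.choose m) fun u hu => ?_).trans ?_
      · refine (choose_le_choose_mul_two_pow hmn (by simpa [Nat.lt_succ_iff] using hu)).trans ?_
        rw [mul_comm]
        exact Nat.mul_le_mul_right _ (Nat.pow_le_pow_left (by norm_num) m)
      · rw [card_range, smul_eq_mul]
        exact Nat.mul_le_mul_right _ (by omega)
    have h8 := Nat.mul_le_mul_right (2 + roundCost n * (n + 1)) h7
    have h9 := Nat.mul_le_mul_left (3 * n + 18) h3
    rw [h6, show roundCost n * (n + 1) + 3 * n + 20 =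
      (2 + roundCost n * (n + 1)) + (3 * n + 18) by ring, add_mul _ (3 * n + 18), mul_comm
      (2 + roundCost n * (n + 1)) ((n + 1) * _)]
    omega
  refine Runs.mono ?_ cost_le fun _ h => h
  have hpow : ∀ i ≤ n, σ 5 ^ i < 2 ^ B := fun i hi => by
    rw [h5]
    exact Nat.pow_lt_pow_right (by norm_num) (by omega)
  refine (runs_powProg (by decide) (by decide) (by omega) h0 hpow h4).seq ?_
  rintro τ ⟨h30, hA⟩
  refine (Runs.copy (Q := (· = Function.update τ 3 (τ 30))) rfl).seq ?_
  rintro _ rfl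
  have r11 : Function.update τ 3 (τ 30) 11 = 0 := by simpa using (hA 11 (by decide)).trans h11
  have r2 : Function.update τ 3 (τ 30) 2 = m := by simpa using (hA 2 (by decide)).trans h2
  have hcount := runs_countProg (O := memberTest F) (B := B) (y := 11) (c := 2) (by decide)
    (by decide) (n := n) (σ := Function.update τ 3 (τ 30)) (by omega)
    (by simpa using (hA 0 (by decide)).trans h0) (by simp [h30, h5])
    (by simpa using (hA 4 (by decide)).trans h4) (by simpa using (hA 5 (by decide)).trans h5)
    (by rw [r11, unionCount_zero_right]; simp)
  rw [r11, r2] at hcount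
  refine hcount.seq ?_
  rintro υ ⟨h24, -⟩
  rw [sum_memberTest_card F hF] at h24
  exact .copy (by simpa using h24)

/-- The program that counts packings. -/
def packingProg : Prog 40 :=
  .const 4 1 ;; .const 5 2 ;;
  .ite 1
    (.arith .sub 30 1 4 ;;
      .ite 30
        (.ite 2
          (.arith .mul 31 1 2 ;; .arith .sub 31 31 0 ;; .ite 31 (.const 0 0) mainProg)
          (.const 0 0))
        (.arith .sub 31 2 0 ;; .ite 31 (.const 0 0) countMembersProg))
    (.copy 0 4)

/-- Degenerate inputs are answered directly: k = 0 has the empty packing only, k = 1 counts the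
family, and for k ≥ 2 either m = 0 or mk > n gives none. The maximum with 1 pays for these answers
when the binomial coefficient vanishes. -/
theorem runs_packingProg {n k m : ℕ} {F : Finset (Finset (Fin n))} (hF : ∀ A ∈ F, A.card = m) :
    Runs (memberTest F) (wordSize n k m) packingProg (input 37 n k m)
      (totalCost n * max 1 (5 ^ (m * ((k + 1) / 2)) * n.choose (m * ((k + 1) / 2))))
      fun τ => τ 0 = (packings F k).card := by
  set M := max 1 (5 ^ (m * ((k + 1) / 2)) * n.choose (m * ((k + 1) / 2))) with hM
  have hM1 : 1 ≤ M := le_max_left _ _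
  have hM2 : 5 ^ (m * ((k + 1) / 2)) * n.choose (m * ((k + 1) / 2)) ≤ M := le_max_right _ _
  have hW : 2 * n * n + 6 * n + 10 ≤ wordSize n k m := by unfold wordSize; omega
  have hW2 : 2 ^ (k + m) * 2 ^ 10 ≤ 2 ^ wordSize n k m := by
    rw [← pow_add]
    exact Nat.pow_le_pow_right (by norm_num) (by unfold wordSize; omega)
  -- The product mk is computed before it is compared with n, so it must fit even if k and m are far
  -- larger than n; hence the summand k + m in the word size.
  have hkm : k * m < 2 ^ (k + m) := by
    rw [pow_add]
    exact Nat.mul_lt_mul'' Nat.lt_two_pow_self Nat.lt_two_pow_self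
  set K := (outerCost n + roundCost n * (n + 1) + 6 * n + 30) * ((n + 1) * M) with hK
  have hK1 : 1 ≤ K := by
    have h1 : 1 ≤ (n + 1) * M := Nat.succ_le_of_lt (by positivity)
    exact Nat.mul_pos (by omega) h1
  have cost_le : K + 1 + 1 + 1 + 1 + 1 + 1 + 1 + 1 + 1 ≤ totalCost n * M := by
    have h1 : 1 ≤ (n + 1) * M := Nat.succ_le_of_lt (by positivity)
    have h2 := Nat.mul_le_mul_left (4 * n + 30) h1
    rw [totalCost, mul_assoc, show outerCost n + roundCost n * (n + 1) + 10 * n + 60 =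
      (outerCost n + roundCost n * (n + 1) + 6 * n + 30) + (4 * n + 30) by ring,
      add_mul _ (4 * n + 30)]
    omega
  refine Runs.mono ?_ cost_le fun _ h => h
  refine .const_seq (by omega) (.const_seq (by omega) ?_)
  set σ := Function.update (Function.update (input 37 n k m) 4 1) 5 2 with hσ
  have h0 : σ 0 = n := by simp [hσ, input]
  have h1 : σ 1 = k := by simp [hσ, input]
  have h2 : σ 2 = m := by simp [hσ, input]
  have h4 : σ 4 = 1 := by simp [hσ]
  have h5 : σ 5 = 2 := by simp [hσ]
  have h11 : σ 11 = 0 := by simp [hσ, input]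
  clear_value σ
  have hzero : ∀ {τ : Fin 40 → ℕ} {N}, packings F k = ∅ → Runs (memberTest F) (wordSize n k m)
      (.const 0 0) τ (K + N) fun τ => τ 0 = (packings F k).card := fun h =>
    (Runs.const (by positivity) (by simp [h])).mono (by omega) fun _ h => h
  refine .ite (fun hk => ?_) fun hk => ?_
  · refine .sub_seq (.ite (fun hk1 => ?_) fun hk1 => ?_)
    · have hk2 : 2 ≤ k := by
        simp [h1, h4] at hk1
        omega
      refine .ite (fun hm => ?_) fun hm => ?_
      · have hm1 : 1 ≤ m := by
          simp [h2] at hm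
          omega
        refine .mul_seq (fun _ => ?_) (.sub_seq (.ite (fun hc => ?_) fun hc => ?_))
        · simp [h1, h2]; omega
        · simp [h0, h1, h2] at hc
          exact hzero (N := 0) (packings_eq_empty_of_lt hF (by rw [mul_comm]; omega))
        · simp [h0, h1, h2] at hc
          refine (runs_mainProg hF hm1 hW hk2 (by rw [mul_comm]; omega) ?_ ?_ ?_ ?_ ?_ ?_).mono
            (Nat.mul_le_mul_left _ (Nat.mul_le_mul_left _ hM2)) fun _ h => h
          all_goals simp [h0, h1, h2, h4, h5, h11]
      · simp [h2] at hm
        subst hm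
        exact hzero (N := 3) (packings_eq_empty_of_card_zero hF hk2)
    · obtain rfl : k = 1 := by
        simp [h1, h4] at hk1
        simp [h1] at hk
        omega
      refine Runs.mono (N := K + 1 + 1) ?_ (by omega) fun _ h => h
      refine .sub_seq (.ite (fun hc => ?_) fun hc => ?_)
      · simp [h0, h2] at hc
        exact hzero (N := 0) (packings_eq_empty_of_lt hF (by omega))
      · simp [h0, h2] at hc
        rw [show (1 + 1) / 2 = 1 from rfl, mul_one] at hM2
        rw [card_packings_one]
        refine (runs_countMembersProg hF (by omega) (by omega) ?_ ?_ ?_ ?_ ?_).mono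
          (Nat.mul_le_mul (by omega) (Nat.mul_le_mul_left _ hM2)) fun _ h => h
        all_goals simp [h0, h2, h4, h5, h11]
  · rw [h1] at hk
    subst hk
    rw [card_packings_zero]
    exact (Runs.copy (by simpa using h4)).mono (by omega) fun _ h => h

end Programs

theorem bounded_input {r n k m B : ℕ} (hn : n ≤ B) (hk : k ≤ B) (hm : m ≤ B) :
    Bounded B (input r n k m) := by
  have h : ∀ a ≤ B, a < 2 ^ B := fun a ha => ha.trans_lt Nat.lt_two_pow_self
  intro i
  unfold input
  split_ifs
  · exact h n hn
  · exact h k hk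
  · exact h m hm
  · positivity

end Packing

theorem theorem5 :
    ∃ (r : ℕ) (P : Packing.Prog (r + 3)) (p q : MvPolynomial (Fin 3) ℕ),
      Packing.CountsPackings P
        (fun n k m => MvPolynomial.eval ![n, k, m] p *
          max 1 (5 ^ (m * ((k + 1) / 2)) * n.choose (m * ((k + 1) / 2))))
        (fun n k m => MvPolynomial.eval ![n, k, m] q) := by
  have hw : ∃ w : MvPolynomial (Fin 3) ℕ, ∀ n k m,
      MvPolynomial.eval ![n, k, m] w = Packing.wordSize n k m :=
    ⟨2 * .X 0 * .X 0 + 6 * .X 0 + .X 1 + .X 2 + 10, fun n k m => by simp [Packing.wordSize]⟩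
  have hc : ∃ c : MvPolynomial (Fin 3) ℕ, ∀ n k m,
      MvPolynomial.eval ![n, k, m] c = Packing.totalCost n :=
    ⟨((21 * .X 0 + 20) * (.X 0 + 1) + 46 * .X 0 + 60 + (21 * .X 0 + 20) * (.X 0 + 1) + 14 * .X 0 + 40 +
      (21 * .X 0 + 20) * (.X 0 + 1) + 10 * .X 0 + 60) * (.X 0 + 1), fun n k m => by
      simp [Packing.totalCost, Packing.outerCost, Packing.innerCost, Packing.roundCost]⟩
  obtain ⟨w, hw⟩ := hw
  obtain ⟨c, hc⟩ := hc
  -- Each step costs at most (w + 1)^2 bit operations, and 37 + 3 = 40 registers hold at most w bits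
  -- each.
  refine ⟨37, Packing.packingProg, c * (w + 1) ^ 2, 40 * w, fun n k m F hF => ?_⟩
  obtain ⟨τ, t, s, hexec, ht, hs, -, h0⟩ := Packing.runs_packingProg (k := k) hF
    (Packing.bounded_input (by unfold Packing.wordSize; omega)
      (by unfold Packing.wordSize; omega) (by unfold Packing.wordSize; omega))
  refine ⟨τ, t, s, hexec, h0, ht.trans (le_of_eq ?_), hs.trans (le_of_eq ?_)⟩
  · simp only [map_mul, map_pow, map_add, map_one, hw, hc]
    ring
  · simp [hw]
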